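/- All groups are finite. For $x,y\in G$ let $\Sigma(\{x,y\})=\bigcup_{t\in\{x,y,xy\}}\bigcup_{g\in G}\langle t\rangle^g$. Two 2-element generating sets $S_1,S_2$ of $G$ form a Beauville structure for $G$ if $\Sigma(S_1)\cap\Sigma(S_2)=\{1\}$. The group $G$ is a Beauville group if its minimum number of generators is $2$ and it has a Beauville structure. A Beauville $p$-group $G$ is of tame type if every lift to $G$ of a Beauville structure of $G/\Phi(G)$, where $\Phi(G)$ is the Frattini subgroup, is a Beauville structure of $G$ (a lift of $\{\bar x_1,\bar y_1\},\{\bar x_2,\bar y_2\}$ being a choice of preimages $\{x_1,y_1\},\{x_2,y_2\}$ in $G$). A $p$-group of maximal class is a group of order $p^n$ and nilpotency class $n-1$ for some $n\ge 2$. Let $p\ge 5$ be a prime, let $G$ be a $p$-group of maximal class, and let $N$ be a non-trivial normal subgroup of $G$ with $|G/N|\ge p^2$. Then $G/N$ is a Beauville group, and it is of tame type. -/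

import Mathlib

/-- `G` is a `p`-group of maximal class: `|G| = p ^ n` and `G` is nilpotent of class `n - 1`,
for some `n ≥ 2` (`p` is meant to be a prime). -/
def IsPGroupOfMaximalClass (p : ℕ) (G : Type*) [Group G] : Prop :=
  Group.IsNilpotent G ∧
    ∃ n : ℕ, 2 ≤ n ∧ Nat.card G = p ^ n ∧ Group.nilpotencyClass G = n - 1

/-- `Σ({x, y})`: the union of all conjugates `⟨t⟩ ^ g = g⁻¹ ⟨t⟩ g`, for `t ∈ {x, y, x * y}`
and `g ∈ G`. -/
def beauvilleSigma {G : Type*} [Group G] (x y : G) : Set G :=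
  {z | ∃ t ∈ ({x, y, x * y} : Set G), ∃ g : G, ∃ w ∈ Subgroup.zpowers t, z = g⁻¹ * w * g}

/-- `S₁ = {x₁, y₁}` and `S₂ = {x₂, y₂}` form a Beauville structure for `G`: they are 2-element
sets of generators of `G` and `Σ(S₁) ∩ Σ(S₂) = 1`. -/
structure IsBeauvilleStructure {G : Type*} [Group G] (x₁ y₁ x₂ y₂ : G) : Prop where
  ne₁ : x₁ ≠ y₁
  ne₂ : x₂ ≠ y₂
  closure₁ : Subgroup.closure {x₁, y₁} = ⊤
  closure₂ : Subgroup.closure {x₂, y₂} = ⊤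
  inter : beauvilleSigma x₁ y₁ ∩ beauvilleSigma x₂ y₂ = {1}

/-- A finite group is a Beauville group if its minimum number of generators is `2` and it has
a Beauville structure. -/
def IsBeauvilleGroup (G : Type*) [Group G] [Finite G] : Prop :=
  Group.rank G = 2 ∧ ∃ x₁ y₁ x₂ y₂ : G, IsBeauvilleStructure x₁ y₁ x₂ y₂

/-- A Beauville group (in practice a `p`-group) is of tame type if every lift to `G` of a
Beauville structure of `G ⧸ Φ(G)` is a Beauville structure of `G`. -/
def IsBeauvilleOfTameType (G : Type*) [Group G] [Finite G] : Prop :=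
  IsBeauvilleGroup G ∧
    ∀ x₁ y₁ x₂ y₂ : G,
      IsBeauvilleStructure (x₁ : G ⧸ frattini G) (y₁ : G ⧸ frattini G)
        (x₂ : G ⧸ frattini G) (y₂ : G ⧸ frattini G) →
      IsBeauvilleStructure x₁ y₁ x₂ y₂

/-! ### Polynomial maps on a cube and the Hall–Petrescu congruence -/

section Cube

open Subgroup
open scoped commutatorElement

variable {G ι : Type*} [Group G] [DecidableEq ι]

/-! Write γ_i for `lcs G i` and C_i for `twoStepCentralizer G i`, and let |G| = p^n. A normal
subgroup of index p^m with 2 ≤ m is γ_m, so a non-trivial N contains γ_{n-1}. The main point is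
`IsMaximalClass.pow_mem_or_pow_mem`: in every generating pair of G, one element has its p-th power
in γ_{n-1}. Hence in every generating pair of Q = G/N one element has p-th power 1. If t₁, t₂ come
from the two halves of a lifted Beauville structure, they are independent modulo Φ(Q), so they
generate Q; a common element of conjugates of ⟨t₁⟩ and ⟨t₂⟩ lies in Φ(Q), and an element of order p
outside Φ(Q) has no non-trivial power there. Since p ≥ 5, Q/Φ(Q) of order p² has room for the six
lines of a Beauville structure.

For the main point, s^p commutes with s, so if s avoids C_2, …, C_{n-2} then s^p descends to
γ_{n-1}. If these centralizers all coincide, a generating pair cannot lie inside the proper subgroup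
C_2. Otherwise let k be the first index with C_k ≠ C_2. A Jacobi computation (`exists_eq_two_mul`)
gives k = 2m, with p ∣ m unless n = k + 2. The p-th power map carries C_i to C_{i+p-1}
(`mem_twoStepCentralizer_of_lt`), which forces k ≤ p. So n = k + 2 ≤ p + 1, and there the p-th power
map modulo γ_{n-1} is a homomorphism killing everything outside C_2 ∪ C_k, hence all of G.

Both uses of p-th powers need commutator expansions of (xy)^p and (xs)^p s^{-p}. These are obtained
by treating n ↦ x^n as a polynomial map on the subsets of a p-element set, where the binomial
coefficients C(p, i) with 0 < i < p appear as exponents. -/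

theorem closure_le_normalizer_closure {A B : Set G} (hinv : ∀ a ∈ A, a⁻¹ ∈ A)
    (h : ∀ a ∈ A, ∀ b ∈ B, ⁅a, b⁆ ∈ closure B) :
    closure A ≤ normalizer (closure B : Set G) := by
  have key : ∀ a ∈ A, ∀ x ∈ closure B, a * x * a⁻¹ ∈ closure B := by
    intro a ha x hx
    have : closure B ≤ (closure B).comap (MulAut.conj a).toMonoidHom := by
      rw [closure_le]
      intro b hb
      have h1 := mul_mem (h a ha b hb) (subset_closure hb)
      simpa [commutatorElement_def] using h1
    simpa using this hx
  rw [closure_le]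
  intro a ha
  simp only [SetLike.mem_coe, mem_normalizer_iff]
  intro x
  refine ⟨key a ha x, fun hx => ?_⟩
  have := key a⁻¹ (hinv a ha) _ hx
  simpa [mul_assoc] using this

theorem commutator_closure_le {A B : Set G} {N : Subgroup G}
    (hA : closure A ≤ normalizer (N : Set G)) (hB : closure B ≤ normalizer (N : Set G))
    (h : ∀ a ∈ A, ∀ b ∈ B, ⁅a, b⁆ ∈ N) : ⁅closure A, closure B⁆ ≤ N := by
  have conj : ∀ u ∈ normalizer (N : Set G), ∀ x ∈ N, u * x * u⁻¹ ∈ N :=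
    fun u hu x hx => (mem_normalizer_iff.1 hu x).1 hx
  have step : ∀ a ∈ A, ∀ b ∈ closure B, ⁅a, b⁆ ∈ N := by
    intro a ha b hb
    induction hb using closure_induction with
    | mem b hb => exact h a ha b hb
    | one => simp
    | mul x y hx hy ihx ihy =>
      rw [show ⁅a, x * y⁆ = ⁅a, x⁆ * (x * ⁅a, y⁆ * x⁻¹) by simp only [commutatorElement_def]; group]
      exact mul_mem ihx (conj x (hB hx) _ ihy)
    | inv x hx ihx =>
      rw [show ⁅a, x⁻¹⁆ = x⁻¹ * ⁅a, x⁆⁻¹ * x⁻¹⁻¹ by simp only [commutatorElement_def]; group]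
      exact conj _ (inv_mem (hB hx)) _ (inv_mem ihx)
  rw [commutator_le]
  intro a ha b hb
  induction ha using closure_induction with
  | mem a ha => exact step a ha b hb
  | one => simp
  | mul x y hx hy ihx ihy =>
    rw [show ⁅x * y, b⁆ = (x * ⁅y, b⁆ * x⁻¹) * ⁅x, b⁆ by simp only [commutatorElement_def]; group]
    exact mul_mem (conj x (hA hx) _ ihy) ihx
  | inv x hx ihx =>
    rw [show ⁅x⁻¹, b⁆ = x⁻¹ * ⁅x, b⁆⁻¹ * x⁻¹⁻¹ by simp only [commutatorElement_def]; group]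
    exact conj _ (inv_mem (hA hx)) _ (inv_mem ihx)

/-- The function on finite subsets of `ι` with value `g` on the supersets of `S`, and `1`
elsewhere. -/
def face (S : Finset ι) (g : G) : Finset ι → G := fun T => if S ⊆ T then g else 1

theorem face_apply (S T : Finset ι) (g : G) : face S g T = if S ⊆ T then g else 1 := rfl

theorem face_mul (S : Finset ι) (g h : G) : face S (g * h) = face S g * face S h := by
  ext T; by_cases hS : S ⊆ T <;> simp [face, hS]

theorem face_one (S : Finset ι) : face S (1 : G) = 1 := by
  ext T; simp [face]

theorem face_inv (S : Finset ι) (g : G) : face S g⁻¹ = (face S g)⁻¹ := by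
  ext T; by_cases hS : S ⊆ T <;> simp [face, hS]

theorem face_commutator (S S' : Finset ι) (g h : G) :
    ⁅face S g, face S' h⁆ = face (S ∪ S') ⁅g, h⁆ := by
  ext T
  by_cases hS : S ⊆ T <;> by_cases hS' : S' ⊆ T <;>
    simp [commutatorElement_def, face, hS, hS', Finset.union_subset_iff]

/-- The group of functions on finite subsets of `ι` generated by the faces `face S g` with
`S ∈ 𝒮` and `g ∈ F |S|`; for `𝒮 = univ` these are the polynomial maps with respect to the
filtration `F`. -/
def cubeGroup (F : ℕ → Subgroup G) (𝒮 : Set (Finset ι)) : Subgroup (Finset ι → G) :=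
  closure {f | ∃ S ∈ 𝒮, ∃ g ∈ F S.card, face S g = f}

theorem face_mem_cubeGroup {F : ℕ → Subgroup G} {𝒮 : Set (Finset ι)} {S : Finset ι}
    (hS : S ∈ 𝒮) {g : G} (hg : g ∈ F S.card) : face S g ∈ cubeGroup F 𝒮 :=
  subset_closure ⟨S, hS, g, hg, rfl⟩

theorem cubeGroup_mono {F F' : ℕ → Subgroup G} {𝒮 𝒮' : Set (Finset ι)} (hF : ∀ i, F i ≤ F' i)
    (h : 𝒮 ⊆ 𝒮') : cubeGroup F 𝒮 ≤ cubeGroup F' 𝒮' := by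
  refine closure_mono ?_
  rintro _ ⟨S, hS, g, hg, rfl⟩
  exact ⟨S, h hS, g, hF _ hg, rfl⟩

theorem cubeGroup_le_normalizer {F F' : ℕ → Subgroup G} (hF' : Antitone F')
    (h : ∀ i j, ⁅F i, F' j⁆ ≤ F' (i + j)) (𝒮 : Set (Finset ι)) {𝒮' : Set (Finset ι)}
    (h𝒮' : IsUpperSet 𝒮') : cubeGroup F 𝒮 ≤ normalizer (cubeGroup F' 𝒮' : Set (Finset ι → G)) := by
  refine closure_le_normalizer_closure ?_ ?_
  · rintro _ ⟨S, hS, g, hg, rfl⟩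
    exact ⟨S, hS, g⁻¹, inv_mem hg, face_inv S g⟩
  · rintro _ ⟨S, hS, g, hg, rfl⟩ _ ⟨S', hS', g', hg', rfl⟩
    rw [face_commutator]
    exact face_mem_cubeGroup (h𝒮' (Finset.subset_union_right) hS')
      (hF' (Finset.card_union_le _ _) (h _ _ (commutator_mem_commutator hg hg')))

theorem commutator_cubeGroup_le {F F' F'' : ℕ → Subgroup G} (hF'' : Antitone F'')
    (h : ∀ i j, ⁅F i, F' j⁆ ≤ F'' (i + j)) (h₁ : ∀ i j, ⁅F i, F'' j⁆ ≤ F'' (i + j))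
    (h₂ : ∀ i j, ⁅F' i, F'' j⁆ ≤ F'' (i + j)) :
    ⁅cubeGroup F (Set.univ : Set (Finset ι)), cubeGroup F' (Set.univ : Set (Finset ι))⁆ ≤
      cubeGroup F'' Set.univ := by
  refine commutator_closure_le (cubeGroup_le_normalizer hF'' h₁ _ isUpperSet_univ)
    (cubeGroup_le_normalizer hF'' h₂ _ isUpperSet_univ) ?_
  rintro _ ⟨S, hS, g, hg, rfl⟩ _ ⟨S', hS', g', hg', rfl⟩
  rw [face_commutator]
  exact face_mem_cubeGroup (Set.mem_univ _)
      (hF'' (Finset.card_union_le _ _) (h _ _ (commutator_mem_commutator hg hg')))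

theorem cubeGroup_apply_eq_one {F : ℕ → Subgroup G} {𝒮 : Set (Finset ι)} {T : Finset ι}
    (hT : ∀ S ∈ 𝒮, ¬ S ⊆ T) {f : Finset ι → G} (hf : f ∈ cubeGroup F 𝒮) : f T = 1 := by
  have : cubeGroup F 𝒮 ≤ (Pi.evalMonoidHom (fun _ : Finset ι => G) T).ker := by
    rw [cubeGroup, closure_le]
    rintro _ ⟨S, hS, g, hg, rfl⟩
    simp [MonoidHom.mem_ker, face, hT S hS]
  exact this hf

theorem cubeGroup_apply_mem {F : ℕ → Subgroup G} {𝒮 : Set (Finset ι)} {N : Subgroup G}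
    (hN : ∀ S ∈ 𝒮, F S.card ≤ N) {f : Finset ι → G} (hf : f ∈ cubeGroup F 𝒮) (T : Finset ι) :
    f T ∈ N := by
  have : cubeGroup F 𝒮 ≤ N.comap (Pi.evalMonoidHom (fun _ : Finset ι => G) T) := by
    rw [cubeGroup, closure_le]
    rintro _ ⟨S, hS, g, hg, rfl⟩
    by_cases h : S ⊆ T
    · simpa [face, h] using hN S hS hg
    · simp [face, h]
  exact this hf

/-- The faces other than those at S generate a subgroup normalized by the whole group, so f is one
face at S times an element trivial at S; evaluating at S identifies the face. -/
theorem mem_cubeGroup_diff_singleton {F : ℕ → Subgroup G} (hF : Antitone F)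
    (hc : ∀ i j, ⁅F i, F j⁆ ≤ F (i + j)) {𝒮 : Set (Finset ι)} (h𝒮 : IsUpperSet 𝒮)
    {S : Finset ι} (hS : S ∈ 𝒮) (hmin : ∀ T ∈ 𝒮, T ⊆ S → T = S) {f : Finset ι → G}
    (hf : f ∈ cubeGroup F 𝒮) (h1 : f S = 1) : f ∈ cubeGroup F (𝒮 \ {S}) := by
  have hup : IsUpperSet (𝒮 \ {S}) := by
    rintro T T' hTT' ⟨hT, hTS⟩
    refine ⟨h𝒮 hTT' hT, ?_⟩
    rintro rfl
    exact hTS (hmin T hT hTT')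
  have hev : ∀ f' ∈ cubeGroup F (𝒮 \ {S}), f' S = 1 := fun f' =>
    cubeGroup_apply_eq_one (fun T hT hTS => hT.2 (hmin T hT.1 hTS))
  have hdec : ∃ g ∈ F S.card, ∃ f' ∈ cubeGroup F (𝒮 \ {S}), f = face S g * f' := by
    have hle : cubeGroup F 𝒮 ≤ cubeGroup F {S} ⊔ cubeGroup F (𝒮 \ {S}) := by
      rw [cubeGroup, closure_le]
      rintro _ ⟨T, hT, g, hg, rfl⟩
      by_cases hTS : T = S
      · exact mem_sup_left (face_mem_cubeGroup (Set.mem_singleton_iff.2 hTS) hg)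
      · exact mem_sup_right (face_mem_cubeGroup (Set.mem_sdiff_singleton.2 ⟨hT, hTS⟩) hg)
    have hmem : f ∈ ((cubeGroup F {S} ⊔ cubeGroup F (𝒮 \ {S}) : Subgroup (Finset ι → G)) :
        Set (Finset ι → G)) := hle hf
    rw [coe_mul_of_left_le_normalizer_right _ _ (cubeGroup_le_normalizer hF hc _ hup)] at hmem
    obtain ⟨a, ha, f', hf', rfl⟩ := hmem
    suffices h : cubeGroup F {S} ≤ ((F S.card).map
        ({ toFun := face S, map_one' := face_one S, map_mul' := face_mul S } :
          G →* (Finset ι → G))) by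
      obtain ⟨g, hg, rfl⟩ := h ha
      exact ⟨g, hg, f', hf', rfl⟩
    rw [cubeGroup, closure_le]
    rintro _ ⟨T, rfl, g, hg, rfl⟩
    exact ⟨g, hg, rfl⟩
  obtain ⟨g, hg, f', hf', rfl⟩ := hdec
  have : g = 1 := by simpa [face, hev f' hf'] using h1
  subst this
  simpa [face_one] using hf'

/-- Sets of cardinality below q are removed one at a time, smallest first, so that each is minimal
in the upper set that remains. -/
theorem mem_cubeGroup_le_card [Finite ι] {F : ℕ → Subgroup G} (hF : Antitone F)
    (hc : ∀ i j, ⁅F i, F j⁆ ≤ F (i + j)) (q : ℕ) {f : Finset ι → G}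
    (hf : f ∈ cubeGroup F Set.univ) (h1 : ∀ T : Finset ι, T.card < q → f T = 1) :
    f ∈ cubeGroup F {S | q ≤ S.card} := by
  classical
  have key : ∀ (n : ℕ) (𝒮 : Set (Finset ι)), IsUpperSet 𝒮 → {S ∈ 𝒮 | S.card < q}.ncard = n →
      f ∈ cubeGroup F 𝒮 → f ∈ cubeGroup F {S | q ≤ S.card} := by
    intro n
    induction n with
    | zero =>
      intro 𝒮 h𝒮 hn hf𝒮
      refine cubeGroup_mono (fun _ => le_rfl) (fun S hS => ?_) hf𝒮
      by_contra hlt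
      rw [Set.ncard_eq_zero] at hn
      exact (hn ▸ (⟨hS, not_le.1 hlt⟩ : S ∈ {S ∈ 𝒮 | S.card < q}) : S ∈ (∅ : Set (Finset ι)))
    | succ n ih =>
      intro 𝒮 h𝒮 hn hf𝒮
      have hne : {S ∈ 𝒮 | S.card < q}.Nonempty := by
        rw [← Set.ncard_pos]; omega
      obtain ⟨S, ⟨hS, hSq⟩, hmin⟩ := Set.exists_min_image _ Finset.card (Set.toFinite _) hne
      have hmin' : ∀ T ∈ 𝒮, T ⊆ S → T = S := fun T hT hTS =>
        Finset.eq_of_subset_of_card_le hTS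
          (hmin T ⟨hT, (Finset.card_le_card hTS).trans_lt hSq⟩)
      refine ih (𝒮 \ {S}) ?_ ?_ (mem_cubeGroup_diff_singleton hF hc h𝒮 hS hmin' hf𝒮 (h1 S hSq))
      · rintro T T' hTT' ⟨hT, hTS⟩
        refine ⟨h𝒮 hTT' hT, ?_⟩
        rintro rfl
        exact hTS (hmin' T hT hTT')
      · have : {T ∈ 𝒮 \ {S} | T.card < q} = {T ∈ 𝒮 | T.card < q} \ {S} := by
          ext T; simp only [Set.mem_sdiff, Set.mem_ofPred_eq]; tauto
        rw [this, Set.ncard_sdiff_singleton_of_mem (by exact ⟨hS, hSq⟩), hn]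
        rfl
  exact key _ _ isUpperSet_univ rfl hf

/-- On the supersets of `S`, the function `T ↦ c ^ (|A ∩ T|.choose i)`. -/
def faceChoose (S A : Finset ι) (i : ℕ) (c : G) : Finset ι → G :=
  fun T => if S ⊆ T then c ^ ((A ∩ T).card.choose i) else 1

theorem faceChoose_apply (S A T : Finset ι) (i : ℕ) (c : G) :
    faceChoose S A i c T = if S ⊆ T then c ^ ((A ∩ T).card.choose i) else 1 := by
  rfl

theorem faceChoose_zero (S A : Finset ι) (c : G) : faceChoose S A 0 c = face S c := by
  ext T; simp [faceChoose_apply, face]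

theorem faceChoose_empty_succ (S : Finset ι) (i : ℕ) (c : G) : faceChoose S ∅ (i + 1) c = 1 := by
  ext T; simp [faceChoose_apply]

theorem faceChoose_insert_succ (S A : Finset ι) (i : ℕ) (c : G) {a : ι} (ha : a ∉ A) :
    faceChoose S (insert a A) (i + 1) c =
      faceChoose S A (i + 1) c * faceChoose (insert a S) A i c := by
  ext T
  rw [Pi.mul_apply]
  simp only [faceChoose_apply, Finset.insert_subset_iff]
  by_cases hS : S ⊆ T
  · by_cases haT : a ∈ T
    · have h1 : a ∉ A ∩ T := fun h => ha (Finset.mem_inter.1 h).1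
      simp only [hS, haT, Finset.insert_inter_of_mem haT, Finset.card_insert_of_notMem h1,
        Nat.choose_succ_succ, pow_add, if_true, and_self]
      rw [← pow_add, ← pow_add, add_comm]
    · simp [hS, haT, Finset.insert_inter_of_notMem haT]
  · simp [hS]

/-- Pascal's rule moves an element from A to S while lowering i, which keeps the weight |S| + i. -/
theorem faceChoose_mem_cubeGroup {F : ℕ → Subgroup G} (S A : Finset ι) (hSA : Disjoint S A)
    (i : ℕ) {c : G} (hc : c ∈ F (S.card + i)) : faceChoose S A i c ∈ cubeGroup F Set.univ := by
  induction A using Finset.induction_on generalizing S i with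
  | empty =>
    cases i with
    | zero => rw [faceChoose_zero]; exact face_mem_cubeGroup (Set.mem_univ _) hc
    | succ i => rw [faceChoose_empty_succ]; exact one_mem _
  | insert a A ha ih =>
    rw [Finset.disjoint_insert_right] at hSA
    cases i with
    | zero => rw [faceChoose_zero]; exact face_mem_cubeGroup (Set.mem_univ _) hc
    | succ i =>
      rw [faceChoose_insert_succ S A i c ha]
      refine mul_mem (ih S hSA.2 _ hc) (ih (insert a S) ?_ i ?_)
      · rw [Finset.disjoint_insert_left]; exact ⟨ha, hSA.2⟩
      · rw [Finset.card_insert_of_notMem hSA.1]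
        convert hc using 2; omega

theorem pow_card_mem_cubeGroup [Fintype ι] {F : ℕ → Subgroup G} {c : G} (hc : c ∈ F 1) :
    (fun T : Finset ι => c ^ T.card) ∈ cubeGroup F (Set.univ : Set (Finset ι)) := by
  have := faceChoose_mem_cubeGroup (F := F) (∅ : Finset ι) Finset.univ
    (Finset.disjoint_empty_left _) 1 (c := c) (by simpa using hc)
  convert this using 1
  ext T; simp [faceChoose_apply]

/-- A polynomial map depending only on the cardinality and vanishing below `q` has its value at `p`
in every subgroup containing `F p` and the `p`-th powers of elements of `F q`. -/
theorem symmetric_cubeGroup_apply_mem [Fintype ι] {p : ℕ} (hp : p.Prime)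
    (hι : Fintype.card ι = p) {F : ℕ → Subgroup G} (hF : Antitone F)
    (hc : ∀ i j, ⁅F i, F j⁆ ≤ F (i + j)) {R : Subgroup G} (hRp : F p ≤ R) {q : ℕ} (hq : 1 ≤ q)
    (hqp : q ≤ p) (hR : ∀ c ∈ F q, c ^ p ∈ R) {φ : ℕ → G}
    (hf : (fun T : Finset ι => φ T.card) ∈ cubeGroup F (Set.univ : Set (Finset ι)))
    (h1 : ∀ i < q, φ i = 1) : φ p ∈ R := by
  induction hqp using Nat.decreasingInduction generalizing φ with
  | self =>
    have := mem_cubeGroup_le_card hF hc p hf (fun T hT => h1 _ hT)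
    have h2 := cubeGroup_apply_mem (N := R)
      (fun S (hS : p ≤ S.card) => (hF hS).trans hRp) this Finset.univ
    simpa [hι] using h2
  | of_succ q hqp ih =>
    have hqmem : φ q ∈ F q := by
      have := mem_cubeGroup_le_card hF hc q hf (fun T hT => h1 _ hT)
      obtain ⟨T, -, hT⟩ := Finset.exists_subset_card_eq
        (s := (Finset.univ : Finset ι)) (n := q) (by rw [Finset.card_univ, hι]; omega)
      have h2 := cubeGroup_apply_mem (N := F q) (fun S (hS : q ≤ S.card) => hF hS) this T
      simpa [hT] using h2
    have hb := faceChoose_mem_cubeGroup (F := F) (∅ : Finset ι) Finset.univ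
      (Finset.disjoint_empty_left _) q (c := φ q) (by simpa using hqmem)
    -- Dividing by n ↦ φ(q)^C(n, q) removes the value at q without disturbing the smaller ones.
    have h3 : (φ q ^ (p.choose q))⁻¹ * φ p ∈ R := by
      refine ih (by omega) (fun c hc' => hR c (hF (Nat.le_succ q) hc'))
        (φ := fun n => (φ q ^ (n.choose q))⁻¹ * φ n) ?_ ?_
      · have := mul_mem (inv_mem hb) hf
        convert this using 1
        ext T; simp [faceChoose_apply]
      · intro i hi
        rcases Nat.lt_succ_iff_lt_or_eq.1 hi with h | rfl
        · simp [Nat.choose_eq_zero_of_lt h, h1 i h]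
        · simp
    -- As 1 ≤ q < p, the correction at n = p is a power of φ(q)^p.
    obtain ⟨d, hd⟩ := hp.dvd_choose_self (k := q) (by omega) (by omega)
    have h4 : φ q ^ (p.choose q) ∈ R := by
      rw [hd, pow_mul]; exact pow_mem (hR _ hqmem) d
    have := mul_mem h4 h3
    simpa using this

/-- The Hall–Petrescu congruence for a filtration `F`. -/
theorem pow_mul_congr {p : ℕ} (hp : p.Prime) {F : ℕ → Subgroup G} (hF : Antitone F)
    (hc : ∀ i j, ⁅F i, F j⁆ ≤ F (i + j)) {R : Subgroup G} (hRp : F p ≤ R)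
    (hR : ∀ c ∈ F 2, c ^ p ∈ R) {x y : G} (hx : x ∈ F 1) (hy : y ∈ F 1) :
    ((x * y) ^ p)⁻¹ * (x ^ p * y ^ p) ∈ R := by
  -- The quotient is trivial at n = 0 and n = 1, hence only p-th powers from `F 2` matter.
  refine symmetric_cubeGroup_apply_mem (ι := Fin p) hp (Fintype.card_fin p) hF hc hRp one_le_two
    hp.two_le hR (φ := fun n => ((x * y) ^ n)⁻¹ * (x ^ n * y ^ n)) ?_ ?_
  · exact mul_mem (inv_mem (pow_card_mem_cubeGroup (mul_mem hx hy)))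
      (mul_mem (pow_card_mem_cubeGroup hx) (pow_card_mem_cubeGroup hy))
  · intro i hi
    interval_cases i <;> simp

end Cube

/-! ### The lower central series as a filtration -/

section LowerCentral

open Subgroup
open scoped commutatorElement

theorem commutator_commutator_le_of_rotate {G : Type*} [Group G] {H₁ H₂ H₃ N : Subgroup G}
    [N.Normal] (h1 : ⁅⁅H₂, H₃⁆, H₁⁆ ≤ N) (h2 : ⁅⁅H₃, H₁⁆, H₂⁆ ≤ N) : ⁅⁅H₁, H₂⁆, H₃⁆ ≤ N := by
  have key : ∀ H : Subgroup G, H ≤ N ↔ H.map (QuotientGroup.mk' N) = ⊥ := fun H => by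
    rw [Subgroup.map_eq_bot_iff, QuotientGroup.ker_mk']
  rw [key, map_commutator, map_commutator] at h1 h2 ⊢
  exact commutator_commutator_eq_bot_of_rotate h1 h2

/-- The lower central series indexed from `1`: `lcs G 1 = ⊤` and `lcs G (i + 1) = ⁅lcs G i, ⊤⁆`
for `1 ≤ i`. By convention `lcs G 0 = ⊤`. -/
def lcs (G : Type*) [Group G] (i : ℕ) : Subgroup G := (⊤ : Subgroup G).lowerCentralSeries (i - 1)

variable {G : Type*} [Group G]

theorem lcs_succ {i : ℕ} (hi : 1 ≤ i) : lcs G (i + 1) = ⁅lcs G i, ⊤⁆ := by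
  obtain ⟨i, rfl⟩ := Nat.exists_eq_add_of_le' hi
  rfl

instance lcs_normal (i : ℕ) : (lcs G i).Normal := by
  unfold lcs; infer_instance

theorem lcs_antitone : Antitone (lcs G) := fun _ _ h =>
  Subgroup.lowerCentralSeries_antitone _ (Nat.sub_le_sub_right h 1)

/-- Three subgroups lemma, by induction on j; at index 0 the term is the whole group and the claim
is normality. -/
theorem commutator_lcs_le (i j : ℕ) : ⁅lcs G i, lcs G j⁆ ≤ lcs G (i + j) := by
  rcases Nat.eq_zero_or_pos i with rfl | hi
  · simpa using commutator_le_right (lcs G 0) (lcs G j)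
  induction j generalizing i with
  | zero => exact commutator_le_left _ _
  | succ j ih =>
    rcases Nat.eq_zero_or_pos j with rfl | hj
    · rw [lcs_succ hi]; exact commutator_mono le_rfl le_top
    rw [lcs_succ hj, commutator_comm]
    refine commutator_commutator_le_of_rotate ?_ ?_
    · rw [commutator_comm ⊤, ← lcs_succ hi]
      exact (ih (i + 1) (by omega)).trans (by rw [show i + 1 + j = i + (j + 1) by omega])
    · exact (commutator_mono (ih i hi) le_rfl).trans
        (by rw [← lcs_succ (by omega)]; exact le_of_eq (by congr 1))

theorem commutator_mem_lcs {i j : ℕ} {x y : G} (hx : x ∈ lcs G i) (hy : y ∈ lcs G j) :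
    ⁅x, y⁆ ∈ lcs G (i + j) :=
  commutator_lcs_le i j (commutator_mem_commutator hx hy)

theorem mem_lcs_of_le {i j : ℕ} (h : i ≤ j) {x : G} (hx : x ∈ lcs G j) : x ∈ lcs G i :=
  lcs_antitone h hx

theorem iterate_commutator_mem_lcs (s : G) {j : ℕ} {x : G} (hx : x ∈ lcs G j) (i : ℕ) :
    (fun z => ⁅s, z⁆)^[i] x ∈ lcs G (j + i) := by
  induction i with
  | zero => exact hx
  | succ i ih =>
    rw [Function.iterate_succ_apply']
    have := commutator_mem_lcs (show s ∈ lcs G 1 from mem_top s) ih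
    rwa [show 1 + (j + i) = j + (i + 1) by omega] at this

end LowerCentral

/-! ### Calculating modulo the derived subgroup of a subgroup -/

section AbelianizedClass

open Subgroup
open scoped commutatorElement

variable {Γ : Type*} [Group Γ]

open scoped Classical in
/-- The class of an element of the subgroup `K` in the abelianization of `K`, and `1` outside
of `K`. -/
noncomputable def abelianizedClass (K : Subgroup Γ) (f : Γ) : Abelianization K :=
  if h : f ∈ K then Abelianization.of ⟨f, h⟩ else 1

theorem abelianizedClass_of_mem {K : Subgroup Γ} {f : Γ} (h : f ∈ K) :
    abelianizedClass K f = Abelianization.of ⟨f, h⟩ := dif_pos h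

theorem abelianizedClass_one (K : Subgroup Γ) : abelianizedClass K 1 = 1 := by
  rw [abelianizedClass_of_mem (one_mem K)]; exact map_one _

theorem abelianizedClass_mul {K : Subgroup Γ} {f f' : Γ} (h : f ∈ K) (h' : f' ∈ K) :
    abelianizedClass K (f * f') = abelianizedClass K f * abelianizedClass K f' := by
  rw [abelianizedClass_of_mem h, abelianizedClass_of_mem h', abelianizedClass_of_mem (mul_mem h h'),
    ← map_mul]
  rfl

theorem list_range_prod_mem {K : Subgroup Γ} (f : ℕ → Γ) (hf : ∀ i, f i ∈ K) (q : ℕ) :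
    ((List.range q).map f).prod ∈ K := by
  refine list_prod_mem fun x hx => ?_
  obtain ⟨i, -, rfl⟩ := List.mem_map.1 hx
  exact hf i

theorem abelianizedClass_list_range_prod {K : Subgroup Γ} (f : ℕ → Γ) (hf : ∀ i, f i ∈ K)
    (q : ℕ) : abelianizedClass K ((List.range q).map f).prod =
      ∏ i ∈ Finset.range q, abelianizedClass K (f i) := by
  induction q with
  | zero => simp [abelianizedClass_one]
  | succ q ih =>
    rw [List.range_succ, List.map_append, List.prod_append, List.map_singleton, List.prod_singleton,
      abelianizedClass_mul (list_range_prod_mem f hf q) (hf q), ih, Finset.prod_range_succ]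

theorem inv_mul_mem_of_abelianizedClass_eq {K : Subgroup Γ} {f f' : Γ} (h : f ∈ K) (h' : f' ∈ K)
    (heq : abelianizedClass K f = abelianizedClass K f') : f⁻¹ * f' ∈ ⁅K, K⁆ := by
  rw [abelianizedClass_of_mem h, abelianizedClass_of_mem h'] at heq
  have h2 : (⟨f, h⟩ : K)⁻¹ * ⟨f', h'⟩ ∈ commutator K := QuotientGroup.eq.1 heq
  rw [← map_subtype_commutator]
  exact ⟨_, h2, rfl⟩

theorem abelianizedClass_eq_of_inv_mul_mem {K : Subgroup Γ} {f f' : Γ} (h : f ∈ K) (h' : f' ∈ K)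
    (heq : f⁻¹ * f' ∈ ⁅K, K⁆) : abelianizedClass K f = abelianizedClass K f' := by
  rw [abelianizedClass_of_mem h, abelianizedClass_of_mem h']
  refine QuotientGroup.eq.2 ?_
  rw [← map_subtype_commutator] at heq
  obtain ⟨k, hk, hk'⟩ := heq
  rwa [show (⟨f, h⟩ : K)⁻¹ * ⟨f', h'⟩ = k from Subtype.ext hk'.symm]

theorem conj_mem_of_mem_normalizer {K : Subgroup Γ} {u f : Γ} (hu : u ∈ normalizer (K : Set Γ))
    (hf : f ∈ K) : u * f * u⁻¹ ∈ K := (mem_normalizer_iff.1 hu f).1 hf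

/-- An element normalizing K also normalizes ⁅K, K⁆, so it acts on the abelianization. -/
theorem abelianizedClass_conj_congr {K : Subgroup Γ} {u f f' : Γ}
    (hu : u ∈ normalizer (K : Set Γ)) (h : f ∈ K) (h' : f' ∈ K)
    (heq : abelianizedClass K f = abelianizedClass K f') :
    abelianizedClass K (u * f * u⁻¹) = abelianizedClass K (u * f' * u⁻¹) := by
  refine abelianizedClass_eq_of_inv_mul_mem (conj_mem_of_mem_normalizer hu h)
    (conj_mem_of_mem_normalizer hu h') ?_
  have h1 := inv_mul_mem_of_abelianizedClass_eq h h' heq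
  have hle : ⁅K, K⁆ ≤ ⁅K, K⁆.comap (MulAut.conj u).toMonoidHom := by
    rw [commutator_le]
    intro a ha b hb
    rw [mem_comap, map_commutatorElement]
    exact commutator_mem_commutator (by simpa using conj_mem_of_mem_normalizer hu ha)
      (by simpa using conj_mem_of_mem_normalizer hu hb)
  have h2 := hle h1
  simpa [mul_assoc] using h2

end AbelianizedClass

/-! ### The Engel commutator in the expansion of (xs)^p -/

section EngelTerm

open Subgroup
open scoped commutatorElement

variable {G ι : Type*} [Group G] [DecidableEq ι]

/-- For a single face this is ⁅face {m} s, face S c⁆ = face (S ∪ {m}) ⁅s, c⁆; Pascal's rule extends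
it to `faceChoose`, the two sides being rearranged in the abelianization. -/
theorem abelianizedClass_conj_faceChoose {F₀ F₁ : ℕ → Subgroup G} (hF₁ : Antitone F₁)
    (h01 : ∀ i j, ⁅F₀ i, F₁ j⁆ ≤ F₁ (i + j)) {s : G} (hs : s ∈ F₀ 1) {m : ι} {S A : Finset ι}
    (hSA : Disjoint S A) (hmS : m ∉ S) (hmA : m ∉ A) (i : ℕ) {c : G} (hc : c ∈ F₁ (S.card + i)) :
    abelianizedClass (cubeGroup F₁ Set.univ)
        (face {m} s * faceChoose S A i c * (face {m} s)⁻¹) =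
      abelianizedClass (cubeGroup F₁ Set.univ) (faceChoose S A i c) *
        abelianizedClass (cubeGroup F₁ Set.univ) (faceChoose (insert m S) A i ⁅s, c⁆) := by
  set K := cubeGroup F₁ (Set.univ : Set (Finset ι))
  have hu : face {m} s ∈ normalizer (K : Set (Finset ι → G)) :=
    cubeGroup_le_normalizer hF₁ h01 Set.univ isUpperSet_univ
      (face_mem_cubeGroup (Set.mem_univ _) (by simpa using hs))
  have hcomm : ∀ {c : G} {n : ℕ}, c ∈ F₁ n → ⁅s, c⁆ ∈ F₁ (n + 1) := fun hc => by
    rw [add_comm]; exact h01 _ _ (commutator_mem_commutator hs hc)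
  have hface : ∀ {S : Finset ι} {c : G}, m ∉ S → c ∈ F₁ S.card →
      abelianizedClass K (face {m} s * face S c * (face {m} s)⁻¹) =
        abelianizedClass K (face S c) * abelianizedClass K (face (insert m S) ⁅s, c⁆) := by
    intro S c hmS hc
    have h1 : face S c ∈ K := face_mem_cubeGroup (Set.mem_univ _) hc
    have h2 : face (insert m S) ⁅s, c⁆ ∈ K := face_mem_cubeGroup (Set.mem_univ _)
      (by rw [Finset.card_insert_of_notMem hmS]; exact hcomm hc)
    rw [mul_comm, ← abelianizedClass_mul h2 h1, Finset.insert_eq, ← face_commutator]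
    simp [commutatorElement_def]
  induction A using Finset.induction_on generalizing S i with
  | empty =>
    cases i with
    | zero => simpa only [faceChoose_zero] using hface hmS hc
    | succ i => simp [faceChoose_empty_succ, abelianizedClass_one]
  | insert a A ha ih =>
    rw [Finset.disjoint_insert_right] at hSA
    have hmA' : m ∉ A := fun h => hmA (Finset.mem_insert_of_mem h)
    have hma : m ≠ a := fun h => hmA (h ▸ Finset.mem_insert_self _ _)
    cases i with
    | zero => simpa only [faceChoose_zero] using hface hmS hc
    | succ i =>
      have hd : Disjoint (insert a S) A := by
        rw [Finset.disjoint_insert_left]; exact ⟨ha, hSA.2⟩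
      have hdm : Disjoint (insert m S) A := by
        rw [Finset.disjoint_insert_left]; exact ⟨hmA', hSA.2⟩
      have hdma : Disjoint (insert a (insert m S)) A := by
        rw [Finset.disjoint_insert_left]; exact ⟨ha, hdm⟩
      have hcard : (insert a S).card = S.card + 1 := Finset.card_insert_of_notMem hSA.1
      have hcardm : (insert m S).card = S.card + 1 := Finset.card_insert_of_notMem hmS
      have ham : a ∉ insert m S := by
        rw [Finset.mem_insert, not_or]; exact ⟨hma.symm, hSA.1⟩
      have hcardam : (insert a (insert m S)).card = S.card + 2 := by
        rw [Finset.card_insert_of_notMem ham, hcardm]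
      have hca : c ∈ F₁ ((insert a S).card + i) := by
        rw [hcard]; convert hc using 2; omega
      have hmSa : m ∉ insert a S := by
        rw [Finset.mem_insert, not_or]; exact ⟨hma, hmS⟩
      have m1 : faceChoose S A (i + 1) c ∈ K := faceChoose_mem_cubeGroup S A hSA.2 _ hc
      have m2 : faceChoose (insert a S) A i c ∈ K := faceChoose_mem_cubeGroup _ A hd _ hca
      have m3 : faceChoose (insert m S) A (i + 1) ⁅s, c⁆ ∈ K :=
        faceChoose_mem_cubeGroup _ A hdm _ (by
          rw [hcardm]; convert hcomm hc using 2; omega)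
      have m4 : faceChoose (insert a (insert m S)) A i ⁅s, c⁆ ∈ K :=
        faceChoose_mem_cubeGroup _ A hdma _ (by
          rw [hcardam]; convert hcomm hc using 2; omega)
      rw [faceChoose_insert_succ S A i c ha, faceChoose_insert_succ (insert m S) A i _ ha,
        abelianizedClass_mul m1 m2, abelianizedClass_mul m3 m4,
        show face {m} s * (faceChoose S A (i + 1) c * faceChoose (insert a S) A i c) *
            (face {m} s)⁻¹ = (face {m} s * faceChoose S A (i + 1) c * (face {m} s)⁻¹) *
            (face {m} s * faceChoose (insert a S) A i c * (face {m} s)⁻¹) by group,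
        abelianizedClass_mul (conj_mem_of_mem_normalizer hu m1) (conj_mem_of_mem_normalizer hu m2),
        ih hSA.2 hmS hmA' _ hc, ih hd hmSa hmA' _ hca, Finset.insert_comm m a S]
      exact mul_mul_mul_comm _ _ _ _

/-- The one-variable part of the expansion of `(x s) ^ n s ^ (-n)`. -/
theorem exists_symmetric_cubeGroup_congr [Fintype ι] {F₀ F₁ : ℕ → Subgroup G}
    (hF₁ : Antitone F₁) (h01 : ∀ i j, ⁅F₀ i, F₁ j⁆ ≤ F₁ (i + j)) {s x : G} (hs : s ∈ F₀ 1)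
    (hx : x ∈ F₁ 1) :
    (fun T : Finset ι => ((List.range (Fintype.card ι)).map
          fun i => ((fun z => ⁅s, z⁆)^[i] x) ^ (T.card.choose (i + 1))).prod⁻¹ *
        ((x * s) ^ T.card * (s ^ T.card)⁻¹)) ∈
      ⁅cubeGroup F₁ (Set.univ : Set (Finset ι)), cubeGroup F₁ (Set.univ : Set (Finset ι))⁆ := by
  set K := cubeGroup F₁ (Set.univ : Set (Finset ι)) with hK
  set q := Fintype.card ι
  set y : ℕ → G := fun i => (fun z => ⁅s, z⁆)^[i] x with hy
  have hys : ∀ i, y (i + 1) = ⁅s, y i⁆ := fun i => Function.iterate_succ_apply' _ _ _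
  have hyF : ∀ i, y i ∈ F₁ (i + 1) := by
    intro i
    induction i with
    | zero => exact hx
    | succ i ih =>
      rw [hys, add_comm]; exact h01 _ _ (commutator_mem_commutator hs ih)
  have hu : ∀ m : ι, face {m} s ∈ normalizer (K : Set (Finset ι → G)) := fun m =>
    cubeGroup_le_normalizer hF₁ h01 Set.univ isUpperSet_univ
      (face_mem_cubeGroup (Set.mem_univ _) (by simpa using hs))
  have hd : ∀ (A : Finset ι) (i : ℕ), faceChoose ∅ A (i + 1) (y i) ∈ K := fun A i =>
    faceChoose_mem_cubeGroup _ _ (Finset.disjoint_empty_left _) _ (by simpa using hyF i)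
  -- Counting only the elements of A makes an induction on A possible; A = univ is the case wanted.
  let g : Finset ι → Finset ι → G := fun A T => (x * s) ^ (A ∩ T).card * (s ^ (A ∩ T).card)⁻¹
  let h : Finset ι → Finset ι → G := fun A =>
    ((List.range q).map fun i => faceChoose ∅ A (i + 1) (y i)).prod
  have hh : ∀ A, h A ∈ K := fun A => list_range_prod_mem _ (hd A) q
  have key : ∀ A : Finset ι, g A ∈ K ∧ abelianizedClass K (h A) = abelianizedClass K (g A) := by
    intro A
    induction A using Finset.induction_on with
    | empty =>
      have hg : g ∅ = 1 := by ext T; simp [g]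
      have hh1 : h ∅ = 1 := by
        refine List.prod_eq_one fun f hf => ?_
        obtain ⟨i, -, rfl⟩ := List.mem_map.1 hf
        exact faceChoose_empty_succ _ _ _
      rw [hg, hh1]
      exact ⟨one_mem _, rfl⟩
    | insert m A hm ih =>
      -- This is (xs)^{r+1} s^{-(r+1)} = x · s ((xs)^r s^{-r}) s^{-1} when m ∈ T.
      have hins : g (insert m A) = face {m} x * (face {m} s * g A * (face {m} s)⁻¹) := by
        ext T
        by_cases hmT : m ∈ T
        · have h1 : m ∉ A ∩ T := fun h => hm (Finset.mem_inter.1 h).1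
          simp only [g, Finset.insert_inter_of_mem hmT, Finset.card_insert_of_notMem h1,
            Pi.mul_apply, Pi.inv_apply, face_apply, Finset.singleton_subset_iff, hmT, if_true]
          rw [pow_succ', pow_succ']
          group
        · simp [g, face_apply, Finset.insert_inter_of_notMem hmT, hmT]
      have hxK : face {m} x ∈ K := face_mem_cubeGroup (Set.mem_univ _) (by simpa using hx)
      have hconj : ∀ i, face {m} s * faceChoose ∅ A (i + 1) (y i) * (face {m} s)⁻¹ ∈ K :=
        fun i => conj_mem_of_mem_normalizer (hu m) (hd A i)
      have hdm : ∀ i, faceChoose {m} A i (y i) ∈ K := fun i =>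
        faceChoose_mem_cubeGroup _ _ (Finset.disjoint_singleton_left.2 hm) _
          (by rw [Finset.card_singleton, add_comm]; exact hyF i)
      -- Conjugation by s shifts the index i by one. Against Pascal's rule for A ∪ {m}, the shifted
      -- product lacks i = 0, supplied by `face {m} x`, and has the extra term i = q, trivial
      -- because |A ∩ T| < q.
      have hlast : faceChoose {m} A q (y q) = 1 := by
        ext T
        have : (A ∩ T).card < q := by
          refine (Finset.card_le_card Finset.inter_subset_left).trans_lt ?_
          exact Finset.card_lt_univ_of_notMem hm
        simp [faceChoose_apply, Nat.choose_eq_zero_of_lt this]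
      refine ⟨hins ▸ mul_mem hxK (conj_mem_of_mem_normalizer (hu m) ih.1), ?_⟩
      rw [hins, abelianizedClass_mul hxK (conj_mem_of_mem_normalizer (hu m) ih.1),
        ← abelianizedClass_conj_congr (hu m) (hh A) ih.1 ih.2]
      have e1 : face {m} s * h A * (face {m} s)⁻¹ = ((List.range q).map fun i =>
          face {m} s * faceChoose ∅ A (i + 1) (y i) * (face {m} s)⁻¹).prod := by
        have := map_list_prod (MulAut.conj (face {m} s)).toMonoidHom
          ((List.range q).map fun i => faceChoose ∅ A (i + 1) (y i))
        simpa [List.map_map, Function.comp_def] using this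
      rw [e1, abelianizedClass_list_range_prod _ hconj, abelianizedClass_list_range_prod _ (hd _)]
      have e2 : ∀ i, abelianizedClass K
          (face {m} s * faceChoose ∅ A (i + 1) (y i) * (face {m} s)⁻¹) =
          abelianizedClass K (faceChoose ∅ A (i + 1) (y i)) *
            abelianizedClass K (faceChoose {m} A (i + 1) (y (i + 1))) := by
        intro i
        rw [hys]
        exact abelianizedClass_conj_faceChoose hF₁ h01 hs (Finset.disjoint_empty_left _)
          (Finset.notMem_empty _) hm _ (by simpa using hyF i)
      have e3 : ∀ i, abelianizedClass K (faceChoose ∅ (insert m A) (i + 1) (y i)) =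
          abelianizedClass K (faceChoose ∅ A (i + 1) (y i)) *
            abelianizedClass K (faceChoose {m} A i (y i)) := by
        intro i
        rw [faceChoose_insert_succ _ _ _ _ hm]
        exact abelianizedClass_mul (hd A i) (hdm i)
      simp only [e2, e3, Finset.prod_mul_distrib]
      rw [mul_left_comm]
      congr 1
      have e4 := Finset.prod_range_succ
        (fun i => abelianizedClass K (faceChoose {m} A i (y i))) q
      rw [Finset.prod_range_succ', hlast, abelianizedClass_one, mul_one, faceChoose_zero,
        mul_comm] at e4
      exact e4.symm
  have hfin := inv_mul_mem_of_abelianizedClass_eq (hh Finset.univ) (key Finset.univ).1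
    (key Finset.univ).2
  convert hfin using 1
  ext T
  simp only [h, g, Pi.mul_apply, Pi.inv_apply, Finset.univ_inter, hy]
  congr 2
  have := map_list_prod (Pi.evalMonoidHom (fun _ : Finset ι => G) T)
    ((List.range q).map fun i => faceChoose ∅ Finset.univ (i + 1) ((fun z => ⁅s, z⁆)^[i] x))
  simpa [List.map_map, Function.comp_def, faceChoose_apply] using this.symm

theorem lcs_shift_filtration {a b c : ℕ} (h : c ≤ a + b) (i j : ℕ) :
    ⁅lcs G (a + i), lcs G (b + j)⁆ ≤ lcs G (c + (i + j)) :=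
  (commutator_lcs_le _ _).trans (lcs_antitone (by omega))

/-- Modulo the `p`-th powers of deeper elements, `(x s) ^ p s ^ (-p)` is the product of `x ^ p` and
the Engel commutator `[s, …, [s, x]]` with `p - 1` entries `s`. -/
theorem engel_congr {p : ℕ} (hp : p.Prime) {R : Subgroup G} [R.Normal] {j : ℕ} (hj : 2 ≤ j)
    {x : G} (hx : x ∈ lcs G j) (s : G) (hR : ∀ c ∈ lcs G (j + 1), c ^ p ∈ R)
    (hRj : lcs G (2 * j - 2 + p) ≤ R) :
    (x ^ p * (fun z => ⁅s, z⁆)^[p - 1] x)⁻¹ * ((x * s) ^ p * (s ^ p)⁻¹) ∈ R := by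
  have h01 : ∀ i l, ⁅lcs G (0 + i), lcs G (j - 1 + l)⁆ ≤ lcs G (j - 1 + (i + l)) :=
    lcs_shift_filtration (by omega)
  have hmem := exists_symmetric_cubeGroup_congr (ι := Fin p) (F₀ := fun i => lcs G (0 + i))
    (F₁ := fun i => lcs G (j - 1 + i)) (fun a b h => lcs_antitone (by omega)) h01
    (s := s) (x := x) (mem_top s) (by rwa [Nat.sub_add_cancel (by omega)])
  have hK := commutator_cubeGroup_le (ι := Fin p) (F := fun i => lcs G (j - 1 + i))
    (F' := fun i => lcs G (j - 1 + i)) (F'' := fun i => lcs G (2 * j - 2 + i))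
    (fun a b h => lcs_antitone (by omega)) (lcs_shift_filtration (by omega))
    (lcs_shift_filtration (by omega)) (lcs_shift_filtration (by omega))
  rw [Fintype.card_fin] at hmem
  have hpow : ∀ c ∈ lcs G (j + 1), ∀ k, 0 < k → k < p → c ^ (p.choose k) ∈ R := by
    intro c hc k hk hkp
    obtain ⟨d, hd⟩ := hp.dvd_choose_self (k := k) (by omega) hkp
    rw [hd, pow_mul]
    exact pow_mem (hR c hc) d
  -- The discrepancy lies in ⁅K, K⁆, where the shift is 2j - 2; its weights start at 2j - 1 ≥ j + 1,
  -- so `hR` covers the p-th powers.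
  have hval := symmetric_cubeGroup_apply_mem (ι := Fin p) hp (Fintype.card_fin p)
    (F := fun i => lcs G (2 * j - 2 + i)) (fun a b h => lcs_antitone (by omega))
    (lcs_shift_filtration (by omega)) (R := R) hRj le_rfl hp.one_le
    (fun c hc => hR c (mem_lcs_of_le (by omega) hc))
    (φ := fun n => ((List.range p).map
          fun i => ((fun z => ⁅s, z⁆)^[i] x) ^ (n.choose (i + 1))).prod⁻¹ *
        ((x * s) ^ n * (s ^ n)⁻¹)) (hK hmem) (by
      intro i hi
      obtain rfl : i = 0 := by omega
      simp)
  obtain ⟨m, rfl⟩ : ∃ m, p = m + 2 := ⟨p - 2, by have := hp.two_le; omega⟩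
  have hprod : ((List.range (m + 2)).map
      fun i => ((fun z => ⁅s, z⁆)^[i] x) ^ ((m + 2).choose (i + 1))).prod =
      x ^ (m + 2) * ((List.range m).map
      fun i => ((fun z => ⁅s, z⁆)^[i + 1] x) ^ ((m + 2).choose (i + 2))).prod *
        (fun z => ⁅s, z⁆)^[m + 1] x := by
    rw [List.range_succ, List.range_succ_eq_map]
    simp [List.map_map, Function.comp_def, mul_assoc]
  -- Only the extreme exponents C(p, 1) and C(p, p) survive: in between, p divides the exponent and
  -- the base lies in `lcs G (j + 1)`.
  have hM : ((List.range m).map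
      fun i => ((fun z => ⁅s, z⁆)^[i + 1] x) ^ ((m + 2).choose (i + 2))).prod ∈ R := by
    refine list_prod_mem fun z hz => ?_
    obtain ⟨i, hi, rfl⟩ := List.mem_map.1 hz
    rw [List.mem_range] at hi
    exact hpow _ (mem_lcs_of_le (by omega) (iterate_commutator_mem_lcs s hx (i + 1))) _
      (by omega) (by omega)
  rw [hprod] at hval
  rw [show m + 2 - 1 = m + 1 from rfl]
  generalize ((List.range m).map
      fun i => ((fun z => ⁅s, z⁆)^[i + 1] x) ^ ((m + 2).choose (i + 2))).prod = M at hval hM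
  generalize (fun z => ⁅s, z⁆)^[m + 1] x = y at hval ⊢
  have h2 := mul_mem ((inferInstance : R.Normal).conj_mem M hM y⁻¹) hval
  convert h2 using 1
  group

/-- If all `(x s) ^ p` with `x ∈ lcs G j₀` agree with `s ^ p` modulo `lcs G e`, then
the `p`-th power map on `lcs G j₀` is given, up to sign, by the Engel commutator with `s`. -/
theorem pow_mul_engel_mem {p : ℕ} (hp : p.Prime) {e j₀ : ℕ} (hj₀ : 2 ≤ j₀)
    {s : G} (hs : ∀ x ∈ lcs G j₀, (x * s) ^ p * (s ^ p)⁻¹ ∈ lcs G e) {j : ℕ} (hj : j₀ ≤ j) {x : G}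
    (hx : x ∈ lcs G j) : x ^ p * (fun z => ⁅s, z⁆)^[p - 1] x ∈ lcs G (min (j + p) e) := by
  -- Induction on the distance from j to e. For c in `lcs G (j + 1)` the Engel term lies in `lcs G
  -- (j + p)`, so the deeper case puts c^p into R, as `engel_congr` requires.
  obtain ⟨d, hd⟩ : ∃ d, e ≤ j + d := ⟨e, by omega⟩
  induction d generalizing j x with
  | zero =>
    have h1 : lcs G j ≤ lcs G (min (j + p) e) := lcs_antitone (by omega)
    exact mul_mem (pow_mem (h1 hx) _) (lcs_antitone (by omega) (iterate_commutator_mem_lcs s hx _))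
  | succ d ih =>
    have h1 := engel_congr hp (R := lcs G (min (j + p) e)) (hj₀.trans hj) hx s ?_ (lcs_antitone (by omega))
    · have h2 := lcs_antitone (min_le_right (j + p) e) (hs x (mem_lcs_of_le hj hx))
      have h3 := mul_mem h2 (inv_mem h1)
      rw [mul_inv_rev, inv_inv, mul_inv_cancel_left] at h3
      exact h3
    · intro c hc
      have h2 := mem_lcs_of_le (i := min (j + p) e) (by omega) (ih (by omega) hc (by omega))
      have h3 := mem_lcs_of_le (i := min (j + p) e) (by have := hp.one_le; omega)
        (iterate_commutator_mem_lcs s hc (p - 1))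
      exact (Subgroup.mul_mem_cancel_right _ h3).1 h2

end EngelTerm

/-! ### The Frattini subgroup of a finite p-group -/

section PGroupFrattini

open Subgroup
open scoped commutatorElement

variable {p : ℕ} {G : Type*} [Group G] [Finite G]

theorem commutator_le_and_pow_mem_of_isCoatom (hp : p.Prime) (hG : IsPGroup p G) {M : Subgroup G}
    (hM : IsCoatom M) : commutator G ≤ M ∧ ∀ x : G, x ^ p ∈ M := by
  have : Fact p.Prime := ⟨hp⟩
  have : Group.IsNilpotent G := hG.isNilpotent
  have : M.Normal :=
    NormalizerCondition.normal_of_coatom M Group.normalizerCondition_of_isNilpotent hM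
  have hsup : ∀ H : Subgroup G, M ≤ H → H ≠ ⊤ → H ≤ M := fun H h1 h2 =>
    (hM.le_iff.1 h1).elim (fun h => absurd h h2) (fun h => h.le)
  have : Nontrivial (G ⧸ M) := QuotientGroup.nontrivial_iff.2 hM.1
  constructor
  · have hlt : commutator (G ⧸ M) < ⊤ := Group.IsSolvable.commutator_lt_top_of_nontrivial _
    have h1 : (commutator (G ⧸ M)).comap (QuotientGroup.mk' M) ≤ M := by
      refine hsup _ ?_ ?_
      · intro x hx
        rw [mem_comap, QuotientGroup.mk'_apply, (QuotientGroup.eq_one_iff x).2 hx]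
        exact one_mem _
      · intro h
        refine hlt.ne (eq_top_iff.2 fun y _ => ?_)
        obtain ⟨x, rfl⟩ := QuotientGroup.mk'_surjective M y
        exact mem_comap.1 (h ▸ mem_top x)
    refine le_trans ?_ h1
    rw [← map_le_iff_le_comap, _root_.commutator_def, map_commutator]
    exact commutator_mono le_top le_top
  · intro x
    by_contra hx
    -- Maximality would make x a power of x^p modulo M, so an exponent 1 - pk prime to p would kill
    -- x in the p-group G ⧸ M.
    have htop : M ⊔ zpowers (x ^ p) = ⊤ := by
      by_contra h
      exact hx (hsup _ le_sup_left h (mem_sup_right (mem_zpowers _)))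
    have hxm : x ∈ M ⊔ zpowers (x ^ p) := htop ▸ mem_top x
    rw [mem_sup_of_normal_left] at hxm
    obtain ⟨m, hm, y, hy, hxy⟩ := hxm
    obtain ⟨k, rfl⟩ := mem_zpowers_iff.1 hy
    have hq : (x : G ⧸ M) ^ ((1 : ℤ) - p * k) = 1 := by
      have h2 : (x : G ⧸ M) = ((x : G ⧸ M) ^ p) ^ k := by
        conv_lhs => rw [← hxy]
        rw [QuotientGroup.mk_mul, (QuotientGroup.eq_one_iff m).2 hm, one_mul]
        rfl
      rw [zpow_sub, zpow_one, zpow_mul, zpow_natCast, ← h2, mul_inv_cancel]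
    obtain ⟨r, hr⟩ := (hG.to_quotient M) (x : G ⧸ M)
    have hcop : IsCoprime ((1 : ℤ) - p * k) ((p : ℤ) ^ r) := by
      refine IsCoprime.pow_right ⟨1, k, by ring⟩
    obtain ⟨a, b, hab⟩ := hcop
    have h3 : (x : G ⧸ M) = 1 := by
      have : (x : G ⧸ M) ^ (a * ((1 : ℤ) - p * k) + b * (p : ℤ) ^ r) = 1 := by
        rw [zpow_add, mul_comm a, mul_comm b, zpow_mul, zpow_mul, hq, ← Nat.cast_pow, zpow_natCast,
          hr]
        simp
      rwa [hab, zpow_one] at this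
    exact hx (pow_mem ((QuotientGroup.eq_one_iff x).1 h3) p)

omit [Finite G] in
theorem le_frattini_iff {H : Subgroup G} : H ≤ frattini G ↔ ∀ M : Subgroup G, IsCoatom M → H ≤ M :=
  ⟨fun h _ hM => h.trans (frattini_le_coatom hM), fun h => by
    simpa [frattini, Order.radical] using h⟩

theorem commutator_le_frattini (hp : p.Prime) (hG : IsPGroup p G) : commutator G ≤ frattini G :=
  le_frattini_iff.2 fun _ hM => (commutator_le_and_pow_mem_of_isCoatom hp hG hM).1

theorem pow_mem_frattini (hp : p.Prime) (hG : IsPGroup p G) (x : G) : x ^ p ∈ frattini G := by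
  have : zpowers (x ^ p) ≤ frattini G := le_frattini_iff.2 fun M hM => by
    rw [zpowers_le]; exact (commutator_le_and_pow_mem_of_isCoatom hp hG hM).2 x
  exact this (mem_zpowers _)

theorem closure_eq_top_of_map_frattini {s : Set G}
    (h : closure ((QuotientGroup.mk' (frattini G)) '' s) = ⊤) : closure s = ⊤ := by
  rw [← MonoidHom.map_closure] at h
  refine frattini_nongenerating ?_
  have := congrArg (comap (QuotientGroup.mk' (frattini G))) h
  rwa [comap_map_eq, QuotientGroup.ker_mk', comap_top] at this

theorem isCyclic_of_isCyclic_quotient_frattini (h : IsCyclic (G ⧸ frattini G)) : IsCyclic G := by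
  obtain ⟨g, hg⟩ := h.exists_generator
  obtain ⟨x, rfl⟩ := QuotientGroup.mk'_surjective _ g
  have h1 : closure ({x} : Set G) = ⊤ := by
    apply closure_eq_top_of_map_frattini
    rw [Set.image_singleton, ← zpowers_eq_closure, eq_top_iff]
    exact fun y _ => hg y
  refine ⟨x, fun y => ?_⟩
  have h2 : y ∈ zpowers x := by rw [zpowers_eq_closure, h1]; exact mem_top y
  exact h2

/-- A Frattini quotient of order 1 or p is cyclic, and a generator of it lifts to a generator of G.
-/
theorem sq_le_index_frattini (hp : p.Prime) (hG : IsPGroup p G) (hc : ¬ IsCyclic G) :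
    p ^ 2 ≤ (frattini G).index := by
  have : Fact p.Prime := ⟨hp⟩
  obtain ⟨k, hk⟩ := hG.index (frattini G)
  rw [hk]
  refine Nat.pow_le_pow_right hp.pos ?_
  by_contra hlt
  apply hc
  apply isCyclic_of_isCyclic_quotient_frattini
  have hk' : Nat.card (G ⧸ frattini G) = p ^ k := hk
  interval_cases k
  · have : Subsingleton (G ⧸ frattini G) := by
      rw [pow_zero] at hk'
      exact (Nat.card_eq_one_iff_unique.1 hk').1
    exact isCyclic_of_subsingleton
  · rw [pow_one] at hk'
    exact isCyclic_of_prime_card hk'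

end PGroupFrattini

/-! ### Groups of maximal class and two-step centralizers -/

section MaximalClass

open Subgroup
open scoped commutatorElement

theorem lcs_two (G : Type*) [Group G] : lcs G 2 = commutator G := rfl

variable {p : ℕ} {G : Type*} [Group G]

theorem lcs_succ_lt [Group.IsNilpotent G] {i : ℕ} (hi : 1 ≤ i) (h : lcs G i ≠ ⊥) :
    lcs G (i + 1) < lcs G i := by
  refine lt_of_le_of_ne (lcs_antitone (Nat.le_succ i)) fun heq => h ?_
  have hk : ∀ k, lcs G (i + k) = lcs G i := by
    intro k
    induction k with
    | zero => rfl
    | succ k ih =>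
      rw [← add_assoc, lcs_succ (by omega), ih, ← lcs_succ hi, heq]
  have h2 : lcs G (i + Group.nilpotencyClass G) ≤ lcs G (1 + Group.nilpotencyClass G) :=
    lcs_antitone (by omega)
  rw [hk, add_comm] at h2
  exact le_bot_iff.1 (h2.trans (le_of_eq (Subgroup.lowerCentralSeries_nilpotencyClass (G := G))))

variable [Finite G]

theorem prime_le_relIndex (hp : p.Prime) (hG : IsPGroup p G) {H K : Subgroup G} (h : H < K) :
    p ≤ H.relIndex K := by
  have : Fact p.Prime := ⟨hp⟩
  obtain ⟨k, hk⟩ := (hG.to_subgroup K).index (H.subgroupOf K)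
  rw [relIndex, hk]
  rcases Nat.eq_zero_or_pos k with rfl | hk0
  · exact absurd (relIndex_eq_one.1 (by rw [relIndex, hk, pow_zero])) h.not_ge
  · exact Nat.le_self_pow hk0.ne' p

/-- The first step costs p² because G is not cyclic, and each later strict step costs at least p. -/
theorem pow_le_index_lcs (hp : p.Prime) (hG : IsPGroup p G) {i : ℕ} (hi : 2 ≤ i)
    (h : lcs G i ≠ ⊥) : p ^ i ≤ (lcs G i).index := by
  have : Fact p.Prime := ⟨hp⟩
  have : Group.IsNilpotent G := hG.isNilpotent
  induction i, hi using Nat.le_induction with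
  | base =>
    refine (sq_le_index_frattini hp hG fun hc => h ?_).trans
      (Nat.le_of_dvd (Nat.pos_of_ne_zero index_ne_zero_of_finite)
        (index_dvd_of_le (commutator_le_frattini hp hG)))
    rw [lcs_two]
    have := hc.isMulCommutative
    exact commutator_eq_bot G
  | succ i hi ih =>
    have h1 : lcs G i ≠ ⊥ := fun h0 => h (le_bot_iff.1 (h0 ▸ lcs_antitone (Nat.le_succ i)))
    have hlt := lcs_succ_lt (G := G) (by omega) h1
    rw [← relIndex_mul_index hlt.le, pow_succ']
    exact Nat.mul_le_mul (prime_le_relIndex hp hG hlt) (ih h1)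

/-- A non-abelian group of order `p ^ n` and nilpotency class `n - 1`, described by the indices
of the terms of the lower central series. -/
structure IsMaximalClass (p n : ℕ) (G : Type*) [Group G] : Prop where
  prime : p.Prime
  three_le : 3 ≤ n
  card_eq : Nat.card G = p ^ n
  lcs_eq_bot : lcs G n = ⊥
  index_lcs : ∀ i, 2 ≤ i → i ≤ n → (lcs G i).index = p ^ i

omit [Finite G] in
theorem IsMaximalClass.isPGroup {n : ℕ} (h : IsMaximalClass p n G) : IsPGroup p G :=
  IsPGroup.of_card h.card_eq

theorem isMaximalClass_of_card {n : ℕ} (hp : p.Prime) (hn : 3 ≤ n) (hcard : Nat.card G = p ^ n)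
    [Group.IsNilpotent G] (hcl : Group.nilpotencyClass G = n - 1) : IsMaximalClass p n G := by
  have hG : IsPGroup p G := IsPGroup.of_card hcard
  have hbot : lcs G n = ⊥ := by
    rw [lcs, Subgroup.lowerCentralSeries_eq_bot_iff_nilpotencyClass_le, hcl]
  have hne : ∀ i, 1 ≤ i → i < n → lcs G i ≠ ⊥ := by
    intro i hi1 hi
    rw [lcs, Ne, Subgroup.lowerCentralSeries_eq_bot_iff_nilpotencyClass_le, hcl]
    omega
  have hpos : ∀ H : Subgroup G, 0 < H.index := fun H => Nat.pos_of_ne_zero index_ne_zero_of_finite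
  -- The strict steps below `lcs G i` bound its index from above; `pow_le_index_lcs` bounds it from
  -- below.
  have hupper : ∀ d, ∀ i, 2 ≤ i → i + d = n → (lcs G i).index * p ^ d ≤ p ^ n := by
    intro d
    induction d with
    | zero =>
      intro i _ hi
      obtain rfl : i = n := by omega
      rw [hbot, index_bot, hcard, pow_zero, mul_one]
    | succ d ih =>
      intro i hi2 hi
      refine le_trans ?_ (ih (i + 1) (by omega) (by omega))
      have hlt := lcs_succ_lt (G := G) (by omega) (hne i (by omega) (by omega))
      rw [← relIndex_mul_index hlt.le, pow_succ']
      have := prime_le_relIndex hp hG hlt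
      calc (lcs G i).index * (p * p ^ d) = p * ((lcs G i).index * p ^ d) := by ring
        _ ≤ _ := Nat.mul_le_mul_right _ this
        _ = _ := by ring
  refine ⟨hp, hn, hcard, hbot, fun i hi hin => ?_⟩
  rcases hin.lt_or_eq with hlt | rfl
  · refine le_antisymm ?_ (pow_le_index_lcs hp hG hi (hne i (by omega) hlt))
    have := hupper (n - i) i hi (by omega)
    rw [show n = i + (n - i) by omega, pow_add, show i + (n - i) - i = n - i by omega] at this
    exact Nat.le_of_mul_le_mul_right this (pow_pos hp.pos _)
  · rw [hbot, index_bot, hcard]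

namespace IsMaximalClass

variable {n : ℕ}

omit [Finite G] in
theorem relIndex_lcs (h : IsMaximalClass p n G) {i : ℕ} (hi : 2 ≤ i) (hin : i < n) :
    (lcs G (i + 1)).relIndex (lcs G i) = p := by
  have h1 := relIndex_mul_index (lcs_antitone (G := G) (Nat.le_succ i))
  rw [h.index_lcs i hi hin.le, h.index_lcs (i + 1) (by omega) hin, pow_succ'] at h1
  exact Nat.eq_of_mul_eq_mul_right (pow_pos h.prime.pos i) h1

omit [Finite G] in
theorem lcs_lt (h : IsMaximalClass p n G) {i : ℕ} (hi : 2 ≤ i) (hin : i < n) :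
    lcs G (i + 1) < lcs G i := by
  refine lt_of_le_not_ge (lcs_antitone (Nat.le_succ i)) fun hle => ?_
  have := h.relIndex_lcs hi hin
  rw [relIndex_eq_one.2 hle] at this
  exact h.prime.ne_one this.symm

omit [Finite G] in
-- Consecutive terms have prime index, so no subgroup lies strictly between them.
theorem lcs_le_of_mem (h : IsMaximalClass p n G) {i : ℕ} (hi : 2 ≤ i) (hin : i < n)
    {H : Subgroup G} (hH : lcs G (i + 1) ≤ H) {z : G} (hz : z ∈ lcs G i) (hzH : z ∈ H)
    (hz' : z ∉ lcs G (i + 1)) : lcs G i ≤ H := by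
  have h1 := relIndex_mul_relIndex (lcs G (i + 1)) (H ⊓ lcs G i) (lcs G i)
    (le_inf hH (lcs_antitone (Nat.le_succ i))) inf_le_right
  rw [h.relIndex_lcs hi hin] at h1
  rcases h.prime.eq_one_or_self_of_dvd _ (Dvd.intro _ h1) with h2 | h2
  · exact absurd (relIndex_eq_one.1 h2 ⟨hzH, hz⟩) hz'
  · rw [h2] at h1
    have h3 : (H ⊓ lcs G i).relIndex (lcs G i) = 1 :=
      Nat.eq_of_mul_eq_mul_left h.prime.pos (by rw [h1, mul_one])
    exact (relIndex_eq_one.1 h3).trans inf_le_left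

omit [Finite G] in
theorem not_isCyclic (h : IsMaximalClass p n G) : ¬ IsCyclic G := by
  intro hc
  have := hc.isMulCommutative
  have h1 := h.lcs_lt le_rfl h.three_le
  rw [lcs_two, commutator_eq_bot G] at h1
  exact not_lt_bot h1

theorem frattini_eq (h : IsMaximalClass p n G) : frattini G = lcs G 2 := by
  have h1 : lcs G 2 ≤ frattini G := commutator_le_frattini h.prime h.isPGroup
  refine le_antisymm ?_ h1
  have h2 := sq_le_index_frattini h.prime h.isPGroup h.not_isCyclic
  rw [← h.index_lcs 2 le_rfl (by have := h.three_le; omega), ← relIndex_mul_index h1] at h2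
  rw [← relIndex_eq_one]
  have h3 : 0 < (frattini G).index := Nat.pos_of_ne_zero index_ne_zero_of_finite
  have h4 : 0 < (lcs G 2).relIndex (frattini G) := Nat.pos_of_ne_zero
    (index_ne_zero_of_finite (H := (lcs G 2).subgroupOf (frattini G)))
  nlinarith

theorem pow_mem_lcs_two (h : IsMaximalClass p n G) (x : G) : x ^ p ∈ lcs G 2 :=
  h.frattini_eq ▸ pow_mem_frattini h.prime h.isPGroup x

/-- If `lcs (G ⧸ N) m` were non-trivial, its index would be at least p^m, the order of the quotient.
So `lcs G m ≤ N`, and the indices agree. -/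
theorem eq_lcs_of_index (h : IsMaximalClass p n G) {N : Subgroup G} [N.Normal] {m : ℕ} (hm : 2 ≤ m)
    (hmn : m ≤ n) (hN : N.index = p ^ m) : N = lcs G m := by
  have hcard : Nat.card (G ⧸ N) = p ^ m := hN
  have h1 : lcs (G ⧸ N) m = ⊥ := by
    by_contra hne
    have h2 := pow_le_index_lcs h.prime (h.isPGroup.to_quotient N) hm hne
    have h3 := card_mul_index (lcs (G ⧸ N) m)
    have h4 : 1 < Nat.card (lcs (G ⧸ N) m) := (one_lt_card_iff_ne_bot _).2 hne
    rw [hcard] at h3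
    have := pow_pos h.prime.pos m
    nlinarith
  have h2 : lcs G m ≤ N := by
    have h3 := Subgroup.map_lowerCentralSeries (⊤ : Subgroup G) (QuotientGroup.mk' N) (m - 1)
    rw [map_top_of_surjective _ (QuotientGroup.mk'_surjective N)] at h3
    have h4 : (lcs G m).map (QuotientGroup.mk' N) = ⊥ := h3.trans h1
    rwa [Subgroup.map_eq_bot_iff, QuotientGroup.ker_mk'] at h4
  refine (le_antisymm h2 ?_).symm
  have h5 := relIndex_mul_index h2
  rw [hN, h.index_lcs m hm hmn] at h5
  exact relIndex_eq_one.1 (Nat.eq_of_mul_eq_mul_right (pow_pos h.prime.pos m) (by rw [h5, one_mul]))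

end IsMaximalClass

/-- The elements of `G` centralizing `lcs G i` modulo `lcs G (i + 2)`. -/
def twoStepCentralizer (G : Type*) [Group G] (i : ℕ) : Subgroup G where
  carrier := {g | ∀ x ∈ lcs G i, ⁅g, x⁆ ∈ lcs G (i + 2)}
  one_mem' x _ := by simp
  mul_mem' {a b} ha hb x hx := by
    rw [show ⁅a * b, x⁆ = (a * ⁅b, x⁆ * a⁻¹) * ⁅a, x⁆ by simp only [commutatorElement_def]; group]
    exact mul_mem ((lcs_normal _).conj_mem _ (hb x hx) a) (ha x hx)
  inv_mem' {a} ha x hx := by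
    rw [show ⁅a⁻¹, x⁆ = a⁻¹ * ⁅a, x⁆⁻¹ * a⁻¹⁻¹ by simp only [commutatorElement_def]; group]
    exact (lcs_normal _).conj_mem _ (inv_mem (ha x hx)) _

omit [Finite G] in
theorem mem_twoStepCentralizer {i : ℕ} {g : G} :
    g ∈ twoStepCentralizer G i ↔ ∀ x ∈ lcs G i, ⁅g, x⁆ ∈ lcs G (i + 2) := Iff.rfl

omit [Finite G] in
theorem lcs_two_le_twoStepCentralizer (i : ℕ) : lcs G 2 ≤ twoStepCentralizer G i :=
  fun g hg x hx => by rw [add_comm]; exact commutator_mem_lcs hg hx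

omit [Finite G] in
theorem commutator_mul_right_mem {N : Subgroup G} [N.Normal] {s x y : G}
    (hx : ⁅s, x⁆ ∈ N) (hy : ⁅s, y⁆ ∈ N) : ⁅s, x * y⁆ ∈ N := by
  rw [show ⁅s, x * y⁆ = ⁅s, x⁆ * (x * ⁅s, y⁆ * x⁻¹) by simp only [commutatorElement_def]; group]
  exact mul_mem hx ((inferInstance : N.Normal).conj_mem _ hy x)

/-- The elements commuting with `s` modulo the normal subgroup `N`. -/
def centralizerMod (N : Subgroup G) [N.Normal] (s : G) : Subgroup G where
  carrier := {x | ⁅s, x⁆ ∈ N}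
  one_mem' := by simp
  mul_mem' hx hy := commutator_mul_right_mem hx hy
  inv_mem' {x} (hx : ⁅s, x⁆ ∈ N) := by
    change ⁅s, x⁻¹⁆ ∈ N
    rw [show ⁅s, x⁻¹⁆ = x⁻¹ * ⁅s, x⁆⁻¹ * x⁻¹⁻¹ by simp only [commutatorElement_def]; group]
    exact (inferInstance : N.Normal).conj_mem _ (inv_mem hx) _

omit [Finite G] in
theorem mem_centralizerMod {N : Subgroup G} [N.Normal] {s x : G} :
    x ∈ centralizerMod N s ↔ ⁅s, x⁆ ∈ N := Iff.rfl

omit [Finite G] in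
theorem exists_notMem_and_notMem {H K : Subgroup G} (hH : H ≠ ⊤) (hK : K ≠ ⊤) :
    ∃ g, g ∉ H ∧ g ∉ K := by
  obtain ⟨a, ha⟩ : ∃ a, a ∉ H := by by_contra! h; exact hH (eq_top_iff.2 fun x _ => h x)
  obtain ⟨b, hb⟩ : ∃ b, b ∉ K := by by_contra! h; exact hK (eq_top_iff.2 fun x _ => h x)
  by_cases haK : a ∈ K
  · by_cases hbH : b ∈ H
    · exact ⟨a * b, fun h => ha ((Subgroup.mul_mem_cancel_right _ hbH).1 h),
        fun h => hb ((Subgroup.mul_mem_cancel_left _ haK).1 h)⟩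
    · exact ⟨b, hbH, hb⟩
  · exact ⟨a, ha, haK⟩

namespace IsMaximalClass

variable {n : ℕ}

omit [Finite G] in
theorem twoStepCentralizer_ne_top (h : IsMaximalClass p n G) {i : ℕ} (hi : 2 ≤ i)
    (hin : i + 1 < n) : twoStepCentralizer G i ≠ ⊤ := by
  intro htop
  refine (h.lcs_lt (i := i + 1) (by omega) hin).not_ge ?_
  rw [lcs_succ (i := i) (by omega), commutator_comm, commutator_le]
  exact fun g _ x hx => mem_twoStepCentralizer.1 (htop ▸ mem_top g) x hx

omit [Finite G] in
-- Outside the centralizer, commutation with s is injective from one factor of order p to the next: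
-- commuting with one non-trivial class means commuting with all.
theorem mem_lcs_succ_of_commutator_mem (h : IsMaximalClass p n G) {i : ℕ} (hi : 2 ≤ i)
    (hin : i < n) {s z : G} (hs : s ∉ twoStepCentralizer G i) (hz : z ∈ lcs G i)
    (hsz : ⁅s, z⁆ ∈ lcs G (i + 2)) : z ∈ lcs G (i + 1) := by
  by_contra hz'
  refine hs fun x hx => mem_centralizerMod.1 (h.lcs_le_of_mem hi hin
    (H := centralizerMod (lcs G (i + 2)) s) ?_ hz hsz hz' hx)
  intro y hy
  have := commutator_mem_lcs (show s ∈ lcs G 1 from mem_top s) hy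
  rw [mem_centralizerMod]
  rwa [show 1 + (i + 1) = i + 2 by omega] at this

/-- The power s^p lies in the Frattini subgroup and commutes with s, so injectivity of commutation
pushes it one term deeper at each step. -/
theorem pow_mem_lcs_of_notMem (h : IsMaximalClass p n G) {k : ℕ} (hk : 1 ≤ k) (hkn : k < n) {s : G}
    (hs : ∀ i, 2 ≤ i → i ≤ k → s ∉ twoStepCentralizer G i) : s ^ p ∈ lcs G (k + 1) := by
  induction k, hk using Nat.le_induction with
  | base => exact h.pow_mem_lcs_two s
  | succ k hk ih =>
    refine h.mem_lcs_succ_of_commutator_mem (by omega) hkn (hs (k + 1) (by omega) le_rfl)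
      (ih (by omega) fun i hi hik => hs i hi (by omega)) ?_
    rw [((Commute.refl s).pow_right p).commutator_eq]
    exact one_mem _

/-- Commutation with s is also surjective: ⁅·, s⁆ is multiplicative modulo `lcs G (j + 2)`, and one
non-trivial value generates a factor of order p. -/
theorem exists_commutator_congr (h : IsMaximalClass p n G) {j : ℕ} (hj : 2 ≤ j) (hjn : j + 1 < n)
    {s : G} (hs : s ∉ twoStepCentralizer G j) {x : G} (hx : x ∈ lcs G (j + 1)) :
    ∃ g ∈ lcs G j, x * ⁅g, s⁆⁻¹ ∈ lcs G (j + 2) := by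
  obtain ⟨g, hg, hg'⟩ := SetLike.exists_of_lt (h.lcs_lt hj (by omega))
  set u := ⁅g, s⁆ with hu
  have huj : u ∈ lcs G (j + 1) := commutator_mem_lcs hg (show s ∈ lcs G 1 from mem_top s)
  have hu' : u ∉ lcs G (j + 2) := by
    intro h1
    refine hg' (h.mem_lcs_succ_of_commutator_mem hj (by omega) hs hg ?_)
    rw [← commutatorElement_inv]
    exact inv_mem h1
  have hpow : ∀ a : ℕ, ∃ g ∈ lcs G j, u ^ a * ⁅g, s⁆⁻¹ ∈ lcs G (j + 2) := by
    intro a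
    induction a with
    | zero => exact ⟨1, one_mem _, by simp⟩
    | succ a ih =>
      obtain ⟨g', hg1, hg2⟩ := ih
      refine ⟨g * g', mul_mem hg hg1, ?_⟩
      have h1 : ⁅g, ⁅g', s⁆⁆ ∈ lcs G (j + 2) := mem_lcs_of_le (by omega)
        (commutator_mem_lcs hg (commutator_mem_lcs hg1 (show s ∈ lcs G 1 from mem_top s)))
      convert mul_mem hg2 (inv_mem h1) using 1
      rw [pow_succ, hu]
      simp only [commutatorElement_def]
      group
  have hle : lcs G (j + 1) ≤ zpowers u ⊔ lcs G (j + 2) :=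
    h.lcs_le_of_mem (by omega) hjn le_sup_right huj (mem_sup_left (mem_zpowers u)) hu'
  obtain ⟨y, hy, v, hv, rfl⟩ := mem_sup_of_normal_right.1 (hle hx)
  obtain ⟨a, rfl⟩ := (mem_powers_iff_mem_zpowers.2 hy)
  obtain ⟨g1, hg1, hg2⟩ := hpow a
  refine ⟨g1, hg1, ?_⟩
  have h1 := (lcs_normal (G := G) (j + 2)).conj_mem v hv (u ^ a)
  convert mul_mem h1 hg2 using 1
  group

/-- An element outside the two-step centralizers is conjugate to its translates by elements of
the third term of the lower central series, modulo a deeper term. -/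
theorem exists_conj_mul_inv_mem (h : IsMaximalClass p n G) {k : ℕ} (hkn : k + 1 < n) {s : G}
    (hs : ∀ i, 2 ≤ i → i ≤ k → s ∉ twoStepCentralizer G i) {j : ℕ} (hj : 3 ≤ j) {x : G}
    (hx : x ∈ lcs G j) : ∃ g, x * s * (g * s * g⁻¹)⁻¹ ∈ lcs G (k + 2) := by
  obtain ⟨d, hd⟩ : ∃ d, k + 2 ≤ j + d := ⟨k + 2, by omega⟩
  induction d generalizing j x with
  | zero => exact ⟨1, by simpa using mem_lcs_of_le hd hx⟩
  | succ d ih =>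
    by_cases hjk : k + 2 ≤ j
    · exact ⟨1, by simpa using mem_lcs_of_le hjk hx⟩
    obtain ⟨i, rfl⟩ : ∃ i, j = i + 1 := ⟨j - 1, by omega⟩
    obtain ⟨g, -, hg⟩ := h.exists_commutator_congr (j := i) (by omega) (by omega)
      (hs i (by omega) (by omega)) hx
    -- Since xs = (x⁅g, s⁆⁻¹)(gsg⁻¹), conjugating back by g leaves a translate of s one term deeper.
    obtain ⟨g', hg'⟩ := ih (j := i + 2) (by omega)
      ((lcs_normal (G := G) _).conj_mem _ hg g⁻¹) (by omega)
    refine ⟨g * g', ?_⟩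
    convert (lcs_normal (G := G) _).conj_mem _ hg' g using 1
    simp only [commutatorElement_def]
    group

/-- Modulo `lcs G (k + 2)`, xs is a conjugate of s, and s^p is central because it lies in `lcs G (k
+ 1)`. -/
theorem mul_pow_mul_inv_mem (h : IsMaximalClass p n G) {k : ℕ} (hk : 1 ≤ k) (hkn : k + 1 < n)
    {s : G} (hs : ∀ i, 2 ≤ i → i ≤ k → s ∉ twoStepCentralizer G i) {x : G} (hx : x ∈ lcs G 3) :
    (x * s) ^ p * (s ^ p)⁻¹ ∈ lcs G (k + 2) := by
  obtain ⟨g, hg⟩ := h.exists_conj_mul_inv_mem hkn hs le_rfl hx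
  have h1 : (x * s) ^ p * ((g * s * g⁻¹) ^ p)⁻¹ ∈ lcs G (k + 2) := by
    rw [← QuotientGroup.eq_one_iff] at hg ⊢
    rw [QuotientGroup.mk_mul, QuotientGroup.mk_inv, mul_inv_eq_one] at hg ⊢
    rw [QuotientGroup.mk_pow, hg, QuotientGroup.mk_pow]
  have h2 : ⁅g, s ^ p⁆ ∈ lcs G (k + 2) := by
    have := commutator_mem_lcs (show g ∈ lcs G 1 from mem_top g)
      (h.pow_mem_lcs_of_notMem hk (by omega) hs)
    rwa [show 1 + (k + 1) = k + 2 by omega] at this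
  convert mul_mem h1 h2 using 1
  rw [conj_pow, commutatorElement_def]
  group

end IsMaximalClass
end MaximalClass

/-! ### Jacobi identity in the graded Lie ring and the first change of centralizer -/

section LieRing

open Subgroup
open scoped commutatorElement

variable {p : ℕ} {G : Type*} [Group G]

/-- `φ` induces an isomorphism of `lcs G d ⧸ lcs G (d + 1)` with a subgroup of `ZMod p`. -/
structure IsLcsCoord (p d : ℕ) (φ : G → ZMod p) : Prop where
  map_mul : ∀ x ∈ lcs G d, ∀ y ∈ lcs G d, φ (x * y) = φ x + φ y
  eq_zero_iff : ∀ x ∈ lcs G d, φ x = 0 ↔ x ∈ lcs G (d + 1)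

namespace IsLcsCoord

variable {d : ℕ} {φ : G → ZMod p}

theorem map_mul_right (h : IsLcsCoord p d φ) {x v : G} (hx : x ∈ lcs G d)
    (hv : v ∈ lcs G (d + 1)) : φ (x * v) = φ x := by
  have hv' := mem_lcs_of_le (Nat.le_succ d) hv
  rw [h.map_mul x hx v hv', (h.eq_zero_iff v hv').2 hv, add_zero]

theorem map_pow (h : IsLcsCoord p d φ) {x : G} (hx : x ∈ lcs G d) (a : ℕ) :
    φ (x ^ a) = a * φ x := by
  induction a with
  | zero => simpa using (h.eq_zero_iff 1 (one_mem _)).2 (one_mem _)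
  | succ a ih =>
    rw [pow_succ, h.map_mul _ (pow_mem hx a) _ hx, ih]; push_cast; ring

theorem map_conj (h : IsLcsCoord p d φ) {x : G} (hx : x ∈ lcs G d) (g : G) :
    φ (g * x * g⁻¹) = φ x := by
  have h1 := commutator_mem_lcs hx (show g ∈ lcs G 1 from mem_top g)
  have h2 : g * x * g⁻¹ = x * (x⁻¹ * ⁅x, g⁆⁻¹ * x⁻¹⁻¹) := by
    simp only [commutatorElement_def]; group
  rw [h2]
  exact h.map_mul_right hx ((lcs_normal _).conj_mem _ (inv_mem h1) _)

theorem map_commutator_mul (h : IsLcsCoord p d φ) {i : ℕ} (hi : 1 + i = d) (g : G) {x y : G}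
    (hx : x ∈ lcs G i) (hy : y ∈ lcs G i) : φ ⁅g, x * y⁆ = φ ⁅g, x⁆ + φ ⁅g, y⁆ := by
  have hg : ∀ z ∈ lcs G i, ⁅g, z⁆ ∈ lcs G d := fun z hz =>
    hi ▸ commutator_mem_lcs (show g ∈ lcs G 1 from mem_top g) hz
  rw [show ⁅g, x * y⁆ = ⁅g, x⁆ * (x * ⁅g, y⁆ * x⁻¹) by simp only [commutatorElement_def]; group,
    h.map_mul _ (hg x hx) _ ((lcs_normal _).conj_mem _ (hg y hy) x), h.map_conj (hg y hy)]

/-- Expand s⁅a, b⁆s⁻¹ = ⁅⁅s, a⁆a, ⁅s, b⁆b⁆; as i, j ≥ 1, the conjugations and the remaining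
commutator ⁅⁅s, a⁆, ⁅s, b⁆⁆ are invisible modulo `lcs G (d + 1)`. -/
theorem map_jacobi (h : IsLcsCoord p d φ) {i j : ℕ} (hi : 1 ≤ i) (hj : 1 ≤ j) (hd : i + j + 1 = d)
    (s : G) {a b : G} (ha : a ∈ lcs G i) (hb : b ∈ lcs G j) :
    φ ⁅s, ⁅a, b⁆⁆ = φ ⁅⁅s, a⁆, b⁆ + φ ⁅a, ⁅s, b⁆⁆ := by
  have hs : s ∈ lcs G 1 := mem_top s
  have ha' := commutator_mem_lcs hs ha
  have hb' := commutator_mem_lcs hs hb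
  have hab := commutator_mem_lcs ha hb
  have h1 : ⁅⁅s, a⁆, b⁆ ∈ lcs G d := mem_lcs_of_le (by omega) (commutator_mem_lcs ha' hb)
  have h2 : ⁅a, ⁅s, b⁆⁆ ∈ lcs G d := mem_lcs_of_le (by omega) (commutator_mem_lcs ha hb')
  have h3 : ⁅s, ⁅a, b⁆⁆ ∈ lcs G d := mem_lcs_of_le (by omega) (commutator_mem_lcs hs hab)
  rw [← h.map_mul _ h1 _ h2]
  set N := lcs G (d + 1)
  have hcomm : ∀ {x y : G} {k l : ℕ}, x ∈ lcs G k → y ∈ lcs G l → d + 1 ≤ k + l →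
      Commute (x : G ⧸ N) (y : G ⧸ N) := by
    intro x y k l hx hy hkl
    rw [← commutatorElement_eq_one_iff_commute]
    exact (QuotientGroup.eq_one_iff _).2 (mem_lcs_of_le hkl (commutator_mem_lcs hx hy))
  have hq : ((⁅s, ⁅a, b⁆⁆ : G) : G ⧸ N) = ((⁅⁅s, a⁆, b⁆ * ⁅a, ⁅s, b⁆⁆ : G) : G ⧸ N) := by
    have e1 : ((⁅s, ⁅a, b⁆⁆ * ⁅a, b⁆ : G) : G ⧸ N) =
        ((⁅s, a⁆ * (⁅a, ⁅s, b⁆⁆ * (⁅s, b⁆ * ⁅a, b⁆ * ⁅s, b⁆⁻¹)) * ⁅s, a⁆⁻¹ *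
          (⁅⁅s, a⁆, ⁅s, b⁆⁆ * (⁅s, b⁆ * ⁅⁅s, a⁆, b⁆ * ⁅s, b⁆⁻¹)) : G) : G ⧸ N) := by
      congr 1
      simp only [commutatorElement_def]
      group
    have c1 := hcomm hb' hab (by omega)
    have c2 := hcomm ha' hab (by omega)
    have c3 := hcomm ha' h2 (by omega)
    have c4 := hcomm hb' h1 (by omega)
    have c5 : ((⁅⁅s, a⁆, ⁅s, b⁆⁆ : G) : G ⧸ N) = 1 :=
      (QuotientGroup.eq_one_iff _).2 (mem_lcs_of_le (by omega) (commutator_mem_lcs ha' hb'))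
    have c6 := hcomm hab h1 (by omega)
    have c7 := hcomm h2 h1 (by omega)
    simp only [QuotientGroup.mk_mul, QuotientGroup.mk_inv] at e1 ⊢
    rw [c5, one_mul, c1.eq, mul_inv_cancel_right, c4.eq, mul_inv_cancel_right,
      (c3.mul_right c2).eq, mul_inv_cancel_right, mul_assoc, c6.eq, ← mul_assoc] at e1
    rw [mul_right_cancel e1, c7.eq]
  obtain ⟨v, hv, hv'⟩ : ∃ v ∈ N, ⁅s, ⁅a, b⁆⁆ * v = ⁅⁅s, a⁆, b⁆ * ⁅a, ⁅s, b⁆⁆ :=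
    ⟨_, QuotientGroup.eq.1 hq, by group⟩
  rw [← hv', h.map_mul_right h3 hv]

end IsLcsCoord

variable [Finite G] {n : ℕ}

namespace IsMaximalClass

omit [Finite G] in
theorem exists_isLcsCoord (h : IsMaximalClass p n G) {d : ℕ} (hd : 2 ≤ d) (hdn : d < n) :
    ∃ φ : G → ZMod p, IsLcsCoord p d φ := by
  classical
  have : Fact p.Prime := ⟨h.prime⟩
  set M := (lcs G (d + 1)).subgroupOf (lcs G d)
  have hcard : Nat.card (lcs G d ⧸ M) = Nat.card (Multiplicative (ZMod p)) := by
    rw [Nat.card_congr Multiplicative.toAdd, Nat.card_zmod]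
    exact h.relIndex_lcs hd hdn
  have hcard2 : Nat.card (Multiplicative (ZMod p)) = p := by
    rw [Nat.card_congr Multiplicative.toAdd, Nat.card_zmod]
  let e : lcs G d ⧸ M ≃* Multiplicative (ZMod p) :=
    mulEquivOfPrimeCardEq (p := p) (hcard.trans hcard2) hcard2
  refine ⟨fun x => if hx : x ∈ lcs G d then (e ((⟨x, hx⟩ : lcs G d) : lcs G d ⧸ M)).toAdd else 0,
    ?_, ?_⟩
  · intro x hx y hy
    simp only [hx, hy, mul_mem hx hy, dif_pos]
    rw [← toAdd_mul, ← map_mul, ← QuotientGroup.mk_mul]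
    rfl
  · intro x hx
    simp only [hx, dif_pos]
    rw [toAdd_eq_zero, EmbeddingLike.map_eq_one_iff, QuotientGroup.eq_one_iff]
    rfl

theorem exists_pow_mul_eq (h : IsMaximalClass p n G) {d : ℕ} (hd : 2 ≤ d) (hdn : d < n) {z : G}
    (hz : z ∈ lcs G d) (hz' : z ∉ lcs G (d + 1)) {x : G} (hx : x ∈ lcs G d) :
    ∃ a : ℕ, ∃ v ∈ lcs G (d + 1), x = z ^ a * v := by
  have hle : lcs G d ≤ zpowers z ⊔ lcs G (d + 1) :=
    h.lcs_le_of_mem hd hdn le_sup_right hz (mem_sup_left (mem_zpowers z)) hz'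
  obtain ⟨y, hy, v, hv, rfl⟩ := mem_sup_of_normal_right.1 (hle hx)
  obtain ⟨a, rfl⟩ := (mem_powers_iff_mem_zpowers.2 hy)
  exact ⟨a, v, hv, rfl⟩

/-- Commutation with g is a linear map between one-dimensional spaces, hence a scalar. -/
theorem exists_coord_commutator_eq (h : IsMaximalClass p n G) {d : ℕ} (hd : 2 ≤ d) (hdn : d < n)
    {φ ψ : G → ZMod p} (hφ : IsLcsCoord p d φ) (hψ : IsLcsCoord p (d + 1) ψ) (g : G) :
    ∃ ν : ZMod p, ∀ x ∈ lcs G d, ψ ⁅g, x⁆ = ν * φ x := by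
  have : Fact p.Prime := ⟨h.prime⟩
  obtain ⟨z, hz, hz'⟩ := SetLike.exists_of_lt (h.lcs_lt hd hdn)
  have hφz : φ z ≠ 0 := fun h0 => hz' ((hφ.eq_zero_iff z hz).1 h0)
  have hg : g ∈ lcs G 1 := mem_top g
  refine ⟨ψ ⁅g, z⁆ / φ z, fun x hx => ?_⟩
  obtain ⟨a, v, hv, rfl⟩ := h.exists_pow_mul_eq hd hdn hz hz' hx
  have hpow : ∀ a : ℕ, ψ ⁅g, z ^ a⁆ = a * ψ ⁅g, z⁆ := by
    intro a
    induction a with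
    | zero => simpa using (hψ.eq_zero_iff 1 (one_mem _)).2 (one_mem _)
    | succ a ih =>
      rw [pow_succ, hψ.map_commutator_mul (add_comm 1 d) g (pow_mem hz a) hz, ih]
      push_cast; ring
  have hv0 : ψ ⁅g, v⁆ = 0 := by
    have h1 := commutator_mem_lcs hg hv
    rw [show 1 + (d + 1) = d + 1 + 1 by omega] at h1
    exact (hψ.eq_zero_iff _ (mem_lcs_of_le (by omega) h1)).2 h1
  rw [hψ.map_commutator_mul (add_comm 1 d) g (pow_mem hz a) (mem_lcs_of_le (Nat.le_succ d) hv),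
    hpow, hv0, hφ.map_mul_right (pow_mem hz a) hv, hφ.map_pow hz]
  field_simp
  ring

/-- The subgroup C separates s from y modulo `lcs G 2`, so the two inclusions `lcs G 2 < H ⊓ C < H`
already account for the index p². -/
theorem eq_top_of_mem (h : IsMaximalClass p n G) {C H : Subgroup G} {s y : G} (hC : lcs G 2 ≤ C)
    (hyC : y ∈ C) (hy : y ∉ lcs G 2) (hs : s ∉ C) (hH : lcs G 2 ≤ H) (hyH : y ∈ H) (hsH : s ∈ H) :
    H = ⊤ := by
  have hG := h.isPGroup
  have h1 : lcs G 2 < H ⊓ C :=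
    lt_of_le_of_ne (le_inf hH hC) fun heq => hy (heq ▸ ⟨hyH, hyC⟩)
  have h2 : H ⊓ C < H := lt_of_le_of_ne inf_le_left fun heq => hs (inf_eq_left.1 heq hsH)
  have e1 := relIndex_mul_relIndex _ _ _ h1.le h2.le
  have e2 := relIndex_mul_index hH
  have l1 := prime_le_relIndex h.prime hG h1
  have l2 := prime_le_relIndex h.prime hG h2
  rw [h.index_lcs 2 le_rfl (by have := h.three_le; omega), ← e1] at e2
  have hpos : H.index ≠ 0 := index_ne_zero_of_finite
  rw [← index_eq_one]
  by_contra hne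
  have h3 : 2 ≤ H.index := by omega
  have h4 := Nat.mul_le_mul (Nat.mul_le_mul l1 l2) h3
  rw [e2] at h4
  have := pow_pos h.prime.pos 2
  nlinarith

/-- Otherwise s and y, which generate G modulo `lcs G 2`, make everything commute modulo `lcs G 3`.
-/
theorem commutator_notMem_lcs_three (h : IsMaximalClass p n G) {C : Subgroup G} {s y : G}
    (hC : lcs G 2 ≤ C) (hyC : y ∈ C) (hy : y ∉ lcs G 2) (hs : s ∉ C) : ⁅s, y⁆ ∉ lcs G 3 := by
  intro hsy
  have hle : ∀ g : G, lcs G 2 ≤ centralizerMod (lcs G 3) g := fun g x hx =>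
    commutator_mem_lcs (show g ∈ lcs G 1 from mem_top g) hx
  have hsym : ∀ {g g' : G}, g ∈ centralizerMod (lcs G 3) g' → g' ∈ centralizerMod (lcs G 3) g := by
    intro g g' hg
    rw [mem_centralizerMod, ← commutatorElement_inv]
    exact inv_mem hg
  have hself : ∀ g : G, g ∈ centralizerMod (lcs G 3) g := fun g => by
    rw [mem_centralizerMod, commutatorElement_self]; exact one_mem _
  have h1 := h.eq_top_of_mem hC hyC hy hs (hle s) hsy (hself s)
  have h2 := h.eq_top_of_mem hC hyC hy hs (hle y) (hself y) (hsym hsy)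
  refine (h.lcs_lt le_rfl h.three_le).not_ge ?_
  rw [lcs_succ (i := 1) le_rfl, commutator_le]
  intro g _ g' _
  have h3 : centralizerMod (lcs G 3) g = ⊤ := h.eq_top_of_mem hC hyC hy hs (hle g)
    (hsym (h2 ▸ mem_top g)) (hsym (h1 ▸ mem_top g))
  exact mem_centralizerMod.1 (h3 ▸ mem_top g')

/-- The first two-step centralizer which differs from `twoStepCentralizer G 2` has even index `2 m`,
and it is the last one unless `p ∣ m`. -/
theorem exists_eq_two_mul (h : IsMaximalClass p n G) {k : ℕ} (hk : 3 ≤ k) (hkn : k + 1 < n)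
    {s y : G} (hs : ∀ i, 2 ≤ i → i ≤ k → s ∉ twoStepCentralizer G i)
    (hy : ∀ i, 2 ≤ i → i < k → y ∈ twoStepCentralizer G i) (hyk : y ∉ twoStepCentralizer G k) :
    ∃ m, k = 2 * m ∧ (k + 2 < n → p ∣ m) := by
  have : Fact p.Prime := ⟨h.prime⟩
  have hC2 := lcs_two_le_twoStepCentralizer (G := G) 2
  have hy2 : y ∉ lcs G 2 := fun h0 => hyk (lcs_two_le_twoStepCentralizer k h0)
  have hyC := hy 2 le_rfl (by omega)
  have hsC := hs 2 le_rfl (by omega)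
  -- The shift by one makes e_1 = y and gives e_i weight i.
  set e : ℕ → G := fun i => (fun z => ⁅s, z⁆)^[i - 1] y with he
  have he1 : e 1 = y := rfl
  have hes : ∀ i, 1 ≤ i → e (i + 1) = ⁅s, e i⁆ := by
    intro i hi
    obtain ⟨i, rfl⟩ := Nat.exists_eq_add_of_le' hi
    exact Function.iterate_succ_apply' _ _ _
  have hemem : ∀ i, 1 ≤ i → e i ∈ lcs G i := by
    intro i hi
    have := iterate_commutator_mem_lcs s (j := 1) (show y ∈ lcs G 1 from mem_top y) (i - 1)
    rwa [Nat.add_sub_cancel' hi] at this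
  have hne : ∀ i, 1 ≤ i → i ≤ k + 1 → e i ∉ lcs G (i + 1) := by
    intro i hi
    induction i, hi using Nat.le_induction with
    | base => exact fun _ => hy2
    | succ i hi ih =>
      intro hik h0
      rw [hes i hi] at h0
      rcases Nat.lt_or_ge i 2 with hi2 | hi2
      · obtain rfl : i = 1 := by omega
        exact h.commutator_notMem_lcs_three hC2 hyC hy2 hsC h0
      · exact ih (by omega) (h.mem_lcs_succ_of_commutator_mem hi2 (by omega) (hs i hi2 (by omega))
          (hemem i (by omega)) h0)
  have hcm : ∀ i j, 1 ≤ i → 1 ≤ j → ⁅e i, e j⁆ ∈ lcs G (i + j) := fun i j hi hj =>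
    commutator_mem_lcs (hemem i hi) (hemem j hj)
  -- Through total weight k the brackets of the e_i vanish in the graded ring, because y centralizes
  -- the factors below k; Jacobi with s moves i up.
  have hlow : ∀ i, 1 ≤ i → ∀ j, 1 ≤ j → i + j ≤ k → ⁅e i, e j⁆ ∈ lcs G (i + j + 1) := by
    intro i hi
    induction i, hi using Nat.le_induction with
    | base =>
      intro j hj hjk
      rcases Nat.lt_or_ge j 2 with hj2 | hj2
      · obtain rfl : j = 1 := by omega
        simp
      · rw [show 1 + j + 1 = j + 2 by omega]
        exact hy j hj2 (by omega) _ (hemem j hj)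
    | succ i hi ih =>
      intro j hj hij
      obtain ⟨φ, hφ⟩ := h.exists_isLcsCoord (d := i + j + 1) (by omega) (by omega)
      have hJ := hφ.map_jacobi hi hj rfl s (hemem i hi) (hemem j hj)
      have hL : φ ⁅s, ⁅e i, e j⁆⁆ = 0 := by
        have h1 := commutator_mem_lcs (show s ∈ lcs G 1 from mem_top s) (ih j hj (by omega))
        exact (hφ.eq_zero_iff _ (mem_lcs_of_le (by omega) h1)).2 (mem_lcs_of_le (by omega) h1)
      have h2 := ih (j + 1) (by omega) (by omega)
      rw [← hes i hi, ← hes j hj, hL,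
        (hφ.eq_zero_iff _ (mem_lcs_of_le (by omega) h2)).2 (mem_lcs_of_le (by omega) h2),
        add_zero] at hJ
      have h3 := hcm (i + 1) j (by omega) hj
      rw [show i + 1 + j = i + j + 1 by omega] at h3 ⊢
      exact (hφ.eq_zero_iff _ h3).1 hJ.symm
  obtain ⟨φ, hφ⟩ := h.exists_isLcsCoord (d := k + 1) (by omega) (by omega)
  set μ := φ ⁅y, e k⁆ with hμ
  have hμ0 : μ ≠ 0 := by
    intro h0
    have h1 := commutator_mem_lcs (show y ∈ lcs G 1 from mem_top y) (hemem k (by omega))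
    rw [add_comm 1 k] at h1
    have h2 := (hφ.eq_zero_iff _ h1).1 h0
    refine hyk fun x hx => mem_centralizerMod.1 (h.lcs_le_of_mem (by omega) (by omega)
      (H := centralizerMod (lcs G (k + 2)) y) ?_ (hemem k (by omega)) h2
      (hne k (by omega) (by omega)) hx)
    intro w hw
    have := commutator_mem_lcs (show y ∈ lcs G 1 from mem_top y) hw
    rw [mem_centralizerMod]
    rwa [show 1 + (k + 1) = k + 2 by omega] at this
  -- In weight k + 1 the left side of Jacobi vanishes by `hlow`, so the brackets alternate in sign;
  -- for k odd the middle one is ⁅e_i, e_i⁆ = 1.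
  have hmid : ∀ i, 1 ≤ i → i ≤ k → φ ⁅e i, e (k + 1 - i)⁆ = (-1) ^ (i + 1) * μ := by
    intro i hi
    induction i, hi using Nat.le_induction with
    | base => intro _; simp [he1, hμ]
    | succ i hi ih =>
      intro hik
      have hJ := hφ.map_jacobi hi (j := k - i) (by omega) (by omega) s (hemem i hi)
        (hemem (k - i) (by omega))
      have h1 := commutator_mem_lcs (show s ∈ lcs G 1 from mem_top s)
        (hlow i hi (k - i) (by omega) (by omega))
      rw [← hes i hi, ← hes (k - i) (by omega),
        (hφ.eq_zero_iff _ (mem_lcs_of_le (by omega) h1)).2 (mem_lcs_of_le (by omega) h1),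
        show k - i + 1 = k + 1 - i by omega, ih (by omega)] at hJ
      rw [show k + 1 - (i + 1) = k - i by omega, eq_neg_of_add_eq_zero_left hJ.symm]
      ring
  have heven : ∃ m, k = 2 * m := by
    rcases Nat.even_or_odd' k with ⟨m, hm | hm⟩
    · exact ⟨m, hm⟩
    · exfalso
      have h1 := hmid (m + 1) (by omega) (by omega)
      rw [show k + 1 - (m + 1) = m + 1 by omega, commutatorElement_self,
        (hφ.eq_zero_iff 1 (one_mem _)).2 (one_mem _)] at h1
      exact hμ0 ((mul_eq_zero.1 h1.symm).resolve_left (by simp))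
  obtain ⟨m, hm⟩ := heven
  refine ⟨m, hm, fun hkn2 => ?_⟩
  obtain ⟨ψ, hψ⟩ := h.exists_isLcsCoord (d := k + 2) (by omega) hkn2
  obtain ⟨ν, hν⟩ := h.exists_coord_commutator_eq (by omega) (by omega) hφ hψ s
  obtain ⟨ν', hν'⟩ := h.exists_coord_commutator_eq (by omega) (by omega) hφ hψ y
  -- Apply Jacobi to y, e_2, e_{k-1}: y centralizes both of these factors, while ⁅e_2, e_{k-1}⁆ has
  -- coordinate -μ ≠ 0.
  have hν'0 : ν' = 0 := by
    have hJ := hψ.map_jacobi (i := 2) (j := k - 1) (by omega) (by omega) (by omega) y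
      (hemem 2 (by omega)) (hemem (k - 1) (by omega))
    have h1 := commutator_mem_lcs (hy 2 le_rfl (by omega) _ (hemem 2 (by omega)))
      (hemem (k - 1) (by omega))
    have h2 := commutator_mem_lcs (hemem 2 (by omega))
      (hy (k - 1) (by omega) (by omega) _ (hemem (k - 1) (by omega)))
    have h3 := hmid 2 (by omega) (by omega)
    rw [show k + 1 - 2 = k - 1 by omega] at h3
    have h4 := hcm 2 (k - 1) (by omega) (by omega)
    rw [hν' _ (mem_lcs_of_le (by omega) h4), h3,
      (hψ.eq_zero_iff _ (mem_lcs_of_le (by omega) h1)).2 (mem_lcs_of_le (by omega) h1),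
      (hψ.eq_zero_iff _ (mem_lcs_of_le (by omega) h2)).2 (mem_lcs_of_le (by omega) h2),
      add_zero] at hJ
    exact (mul_eq_zero.1 hJ).resolve_right (mul_ne_zero (by simp) hμ0)
  have hc1 : ψ ⁅e 1, e (k + 1)⁆ = 0 := by
    rw [he1, hν' _ (hemem (k + 1) (by omega)), hν'0, zero_mul]
  -- In weight k + 2 each Jacobi step adds νμ. At i = m + 1 the bracket is ⁅e_i, e_i⁆, whence mνμ =
  -- 0.
  have htop : ∀ i, 1 ≤ i → i ≤ k + 1 →
      (-1) ^ i * ψ ⁅e i, e (k + 2 - i)⁆ = ((i - 1 : ℕ) : ZMod p) * (ν * μ) := by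
    intro i hi
    induction i, hi using Nat.le_induction with
    | base => intro _; simp [hc1]
    | succ i hi ih =>
      intro hik
      have hJ := hψ.map_jacobi hi (j := k + 1 - i) (by omega) (by omega) s (hemem i hi)
        (hemem (k + 1 - i) (by omega))
      have h4 := hcm i (k + 1 - i) hi (by omega)
      rw [← hes i hi, ← hes (k + 1 - i) (by omega), hν _ (mem_lcs_of_le (by omega) h4),
        hmid i hi (by omega), show k + 1 - i + 1 = k + 2 - i by omega] at hJ
      have ih' := ih (by omega)
      rw [show k + 2 - (i + 1) = k + 1 - i by omega, eq_sub_of_add_eq hJ.symm]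
      have hsq : ((-1 : ZMod p) ^ i) * (-1) ^ i = 1 := by rw [← mul_pow]; simp
      have hcast : ((i + 1 - 1 : ℕ) : ZMod p) = ((i - 1 : ℕ) : ZMod p) + 1 := by
        rw [← Nat.cast_add_one]; congr 1; omega
      rw [hcast]
      linear_combination ih' + ν * μ * hsq
  by_contra hpm
  have hm1 := htop (m + 1) (by omega) (by omega)
  rw [show k + 2 - (m + 1) = m + 1 by omega, commutatorElement_self,
    (hψ.eq_zero_iff 1 (one_mem _)).2 (one_mem _), mul_zero, Nat.add_sub_cancel] at hm1
  have hν0 : ν = 0 := by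
    rcases mul_eq_zero.1 hm1.symm with h0 | h0
    · exact absurd ((ZMod.natCast_eq_zero_iff m p).1 h0) hpm
    · exact (mul_eq_zero.1 h0).resolve_right hμ0
  -- With ν = ν' = 0, both s and y would lie in the centralizer of index k + 1, making it all of G.
  refine h.twoStepCentralizer_ne_top (i := k + 1) (by omega) (by omega)
    (h.eq_top_of_mem hC2 hyC hy2 hsC (lcs_two_le_twoStepCentralizer _) ?_ ?_)
  · intro x hx
    have h1 := commutator_mem_lcs (show y ∈ lcs G 1 from mem_top y) hx
    exact (hψ.eq_zero_iff _ (mem_lcs_of_le (by omega) h1)).1 (by rw [hν' x hx, hν'0, zero_mul])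
  · intro x hx
    have h1 := commutator_mem_lcs (show s ∈ lcs G 1 from mem_top s) hx
    exact (hψ.eq_zero_iff _ (mem_lcs_of_le (by omega) h1)).1 (by rw [hν x hx, hν0, zero_mul])

end IsMaximalClass
end LieRing

/-! ### Where p-th powers lie -/

section PowerStructure

open Subgroup
open scoped commutatorElement

variable {p n : ℕ} {G : Type*} [Group G]

theorem mem_of_sq_mem {K : Subgroup G} {g : G} {t : ℕ} (ht : g ^ (2 * t + 1) = 1)
    (hg : g ^ 2 ∈ K) : g ∈ K := by
  rw [pow_succ, pow_mul] at ht
  rw [eq_inv_of_mul_eq_one_right ht]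
  exact inv_mem (pow_mem hg t)

/-- In a group of odd order, a subgroup containing the complement of the union of `H₁` and `H₂`
contains `H₁`, unless that complement is empty. -/
theorem mem_of_compl_union_subset [Finite G] (hodd : Odd (Nat.card G)) {H₁ H₂ K : Subgroup G}
    (hK : ∀ g, g ∉ H₁ → g ∉ H₂ → g ∈ K) {s : G} (hs₁ : s ∉ H₁) (hs₂ : s ∉ H₂) {g : G}
    (hg : g ∈ H₁) : g ∈ K := by
  have hsK := hK s hs₁ hs₂
  have h1 : s * g ∉ H₁ := fun h => hs₁ ((Subgroup.mul_mem_cancel_right _ hg).1 h)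
  by_cases h2 : s * g ∈ H₂
  · have hg2 : g ∉ H₂ := fun h => hs₂ ((Subgroup.mul_mem_cancel_right _ h).1 h2)
    -- The product sg² avoids both subgroups, so g² ∈ K; odd order then gives g ∈ K.
    have h3 : s * g * g ∈ K := hK _ (fun h => h1 ((Subgroup.mul_mem_cancel_right _ hg).1 h))
      (fun h => hg2 ((Subgroup.mul_mem_cancel_left _ h2).1 h))
    rw [mul_assoc, Subgroup.mul_mem_cancel_left _ hsK, ← pow_two] at h3
    obtain ⟨t, ht⟩ := hodd
    exact mem_of_sq_mem (t := t) (by rw [← ht]; exact pow_card_eq_one') h3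
  · exact (Subgroup.mul_mem_cancel_left _ hsK).1 (hK _ h1 h2)

namespace IsMaximalClass

variable [Finite G]

/-- The centralizer is the kernel of a linear form on the two-dimensional G ⧸ `lcs G 2`, so it
contains a non-zero vector. -/
theorem exists_mem_twoStepCentralizer (h : IsMaximalClass p n G) {i : ℕ} (hi : 2 ≤ i)
    (hin : i + 1 < n) : ∃ y ∈ twoStepCentralizer G i, y ∉ lcs G 2 := by
  have : Fact p.Prime := ⟨h.prime⟩
  obtain ⟨φ, hφ⟩ := h.exists_isLcsCoord (d := i + 1) (by omega) hin
  obtain ⟨e, he, he'⟩ := SetLike.exists_of_lt (h.lcs_lt hi (by omega))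
  have hc : ∀ g : G, ⁅g, e⁆ ∈ lcs G (i + 1) := fun g => by
    rw [add_comm]; exact commutator_mem_lcs (show g ∈ lcs G 1 from mem_top g) he
  have hmul : ∀ g g' : G, φ ⁅g * g', e⁆ = φ ⁅g, e⁆ + φ ⁅g', e⁆ := by
    intro g g'
    rw [show ⁅g * g', e⁆ = (g * ⁅g', e⁆ * g⁻¹) * ⁅g, e⁆ by simp only [commutatorElement_def]; group,
      hφ.map_mul _ ((lcs_normal _).conj_mem _ (hc g') g) _ (hc g), hφ.map_conj (hc g'), add_comm]
  have hpow : ∀ (g : G) (a : ℕ), φ ⁅g ^ a, e⁆ = a * φ ⁅g, e⁆ := by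
    intro g a
    induction a with
    | zero => simpa using (hφ.eq_zero_iff 1 (one_mem _)).2 (one_mem _)
    | succ a ih => rw [pow_succ, hmul, ih]; push_cast; ring
  have hmem : ∀ g, φ ⁅g, e⁆ = 0 → g ∈ twoStepCentralizer G i := by
    intro g hg x hx
    refine mem_centralizerMod.1 (h.lcs_le_of_mem hi (by omega)
      (H := centralizerMod (lcs G (i + 2)) g) ?_ he ((hφ.eq_zero_iff _ (hc g)).1 hg) he' hx)
    intro w hw
    have := commutator_mem_lcs (show g ∈ lcs G 1 from mem_top g) hw
    rw [mem_centralizerMod]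
    rwa [show 1 + (i + 1) = i + 2 by omega] at this
  obtain ⟨s, hs, -⟩ := exists_notMem_and_notMem (h.twoStepCentralizer_ne_top hi hin)
    (h.twoStepCentralizer_ne_top hi hin)
  have hs0 : φ ⁅s, e⁆ ≠ 0 := fun h0 => hs (hmem s h0)
  have hne : zpowers s ⊔ lcs G 2 ≠ ⊤ := by
    intro htop
    rw [← h.frattini_eq] at htop
    have h1 := frattini_nongenerating htop
    exact h.not_isCyclic ⟨s, fun y => (h1 ▸ mem_top y : y ∈ zpowers s)⟩
  obtain ⟨y, hy, -⟩ := exists_notMem_and_notMem hne hne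
  -- The exponent cancels the value of the form at y; the result stays outside `lcs G 2` because y
  -- is independent of s.
  refine ⟨s ^ (-(φ ⁅y, e⁆) / φ ⁅s, e⁆).val * y, hmem _ ?_, fun h1 => hy ?_⟩
  · rw [hmul, hpow, ZMod.natCast_val, ZMod.cast_id', id, div_mul_cancel₀ _ hs0]
    ring
  · refine (Subgroup.mul_mem_cancel_left _ ?_).1 (mem_sup_right h1)
    exact mem_sup_left (pow_mem (mem_zpowers s) _)

omit [Finite G] in
theorem mul_notMem_twoStepCentralizer {i : ℕ} {s z : G} (hs : s ∉ twoStepCentralizer G i)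
    (hz : z ∈ lcs G 2) : z * s ∉ twoStepCentralizer G i := fun h =>
  hs ((Subgroup.mul_mem_cancel_left _ (lcs_two_le_twoStepCentralizer i hz)).1 h)

/-- Both p-th powers lie in `lcs G (k + 1)` separately. Compared with `mul_pow_mul_inv_mem`, x may
lie in `lcs G 2`, at the cost of one term. -/
theorem mul_pow_mul_inv_mem' (h : IsMaximalClass p n G) {k : ℕ} (hk : 1 ≤ k) (hkn : k < n)
    {s : G} (hs : ∀ i, 2 ≤ i → i ≤ k → s ∉ twoStepCentralizer G i) {x : G} (hx : x ∈ lcs G 2) :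
    (x * s) ^ p * (s ^ p)⁻¹ ∈ lcs G (k + 1) :=
  mul_mem (h.pow_mem_lcs_of_notMem hk hkn fun i hi hik =>
      mul_notMem_twoStepCentralizer (hs i hi hik) hx)
    (inv_mem (h.pow_mem_lcs_of_notMem hk hkn hs))

omit [Finite G] in
theorem iterate_commutator_notMem (h : IsMaximalClass p n G) {k : ℕ} (hkn : k ≤ n) {s : G}
    (hs : ∀ i, 2 ≤ i → i < k → s ∉ twoStepCentralizer G i) {j : ℕ} (hj : 2 ≤ j) {x : G}
    (hx : x ∈ lcs G j) (hx' : x ∉ lcs G (j + 1)) (i : ℕ) (hi : j + i ≤ k) :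
    (fun z => ⁅s, z⁆)^[i] x ∉ lcs G (j + i + 1) := by
  induction i with
  | zero => exact hx'
  | succ i ih =>
    intro h0
    rw [Function.iterate_succ_apply'] at h0
    exact ih (by omega) (h.mem_lcs_succ_of_commutator_mem (by omega) (by omega)
      (hs _ (by omega) (by omega)) (iterate_commutator_mem_lcs s hx i) h0)

/-- Periodicity of the two-step centralizers. -/
theorem mem_twoStepCentralizer_of_lt (h : IsMaximalClass p n G) (hp : 3 ≤ p) {k : ℕ}
    (hk : p + 1 ≤ k) (hkn : k + 1 < n) {s y : G}
    (hs : ∀ i, 2 ≤ i → i ≤ k → s ∉ twoStepCentralizer G i)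
    (hy : ∀ i, 2 ≤ i → i < k → y ∈ twoStepCentralizer G i) : y ∈ twoStepCentralizer G k := by
  -- The p-th power map behaves like p - 1 commutations with s, so it sends `lcs G m` to `lcs G k`
  -- and its non-trivial classes to non-trivial ones.
  obtain ⟨m, rfl⟩ : ∃ m, k = m + p - 1 := ⟨k + 1 - p, by omega⟩
  have hm : 2 ≤ m := by omega
  set k := m + p - 1 with hkdef
  obtain ⟨x, hx, hx'⟩ := SetLike.exists_of_lt (h.lcs_lt hm (by omega))
  have hdeep : ∀ z ∈ lcs G (m + 2), z ^ p ∈ lcs G (k + 2) := by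
    intro z hz
    have h1 := pow_mul_engel_mem h.prime (e := k + 2) (j₀ := 3) (by omega) (s := s)
      (fun x hx => h.mul_pow_mul_inv_mem (by omega) hkn hs hx) (j := m + 2) (by omega) hz
    have h2 := mem_lcs_of_le (i := k + 2) (by omega) (iterate_commutator_mem_lcs s hz (p - 1))
    exact (Subgroup.mul_mem_cancel_right _ h2).1 (mem_lcs_of_le (by omega) h1)
  have hxp := pow_mul_engel_mem h.prime (e := k + 1) (j₀ := 2) le_rfl (s := s)
    (fun x hx => h.mul_pow_mul_inv_mem' (by omega) (by omega) hs hx) hm hx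
  rw [show min (m + p) (k + 1) = k + 1 by omega] at hxp
  have hE := iterate_commutator_mem_lcs s hx (p - 1)
  rw [show m + (p - 1) = k by omega] at hE
  have hxpk : x ^ p ∈ lcs G k :=
    (Subgroup.mul_mem_cancel_right _ hE).1 (mem_lcs_of_le (Nat.le_succ k) hxp)
  have hxpk' : x ^ p ∉ lcs G (k + 1) := by
    intro h0
    have h1 := h.iterate_commutator_notMem (k := k) (by omega)
      (fun i hi hik => hs i hi hik.le) hm hx hx' (p - 1) (by omega)
    rw [show m + (p - 1) + 1 = k + 1 by omega] at h1
    exact h1 ((Subgroup.mul_mem_cancel_left _ h0).1 hxp)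
  have hc : ⁅y, x⁆ ∈ lcs G (m + 2) := hy m hm (by omega) x hx
  -- Here y x^p y⁻¹ = (⁅y, x⁆x)^p. The filtration `lcs G (i * m)` is deep enough since pm ≥ m + p +
  -- 1 for p ≥ 3, m ≥ 2, and 2m ≥ m + 2.
  have hcong := pow_mul_congr h.prime (F := fun i => lcs G (i * m))
    (fun a b hab => lcs_antitone (Nat.mul_le_mul_right m hab))
    (fun i j => (commutator_lcs_le _ _).trans (by rw [add_mul])) (R := lcs G (k + 2))
    (lcs_antitone (by
      obtain ⟨a, ha⟩ := Nat.exists_eq_add_of_le hp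
      obtain ⟨b, hb⟩ := Nat.exists_eq_add_of_le hm
      rw [hkdef, ha, hb]
      have : (3 + a) * (2 + b) = 6 + 2 * a + 3 * b + a * b := by ring
      omega))
    (fun c hc => hdeep c (mem_lcs_of_le (by omega) hc)) (x := ⁅y, x⁆) (y := x)
    (mem_lcs_of_le (by omega) hc) (by rwa [one_mul])
  have hyx : ⁅y, x ^ p⁆ ∈ lcs G (k + 2) := by
    have h1 := hdeep _ hc
    rw [show ⁅y, x⁆ * x = y * x * y⁻¹ by simp [commutatorElement_def], conj_pow,
      ← QuotientGroup.eq_one_iff] at hcong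
    rw [← QuotientGroup.eq_one_iff] at h1 ⊢
    rw [QuotientGroup.mk_mul, QuotientGroup.mk_mul, h1, one_mul, QuotientGroup.mk_inv,
      inv_mul_eq_one] at hcong
    rw [commutatorElement_def, QuotientGroup.mk_mul, hcong, QuotientGroup.mk_inv, mul_inv_cancel]
  intro w hw
  refine mem_centralizerMod.1 (h.lcs_le_of_mem (by omega) (by omega)
    (H := centralizerMod (lcs G (k + 2)) y) ?_ hxpk hyx hxpk' hw)
  intro w hw
  have := commutator_mem_lcs (show y ∈ lcs G 1 from mem_top y) hw
  rw [mem_centralizerMod]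
  rwa [show 1 + (k + 1) = k + 2 by omega] at this

/-- In a small group of maximal class all `p`-th powers lie in the last term of the lower central
series. -/
theorem pow_mem_of_le (h : IsMaximalClass p n G) (hp : 3 ≤ p) {k : ℕ} (hk : 2 ≤ k)
    (hkn : k + 2 = n) (hnp : n ≤ p + 1)
    (hC : ∀ i, 2 ≤ i → i < k → twoStepCentralizer G i = twoStepCentralizer G 2) (g : G) :
    g ^ p ∈ lcs G (k + 1) := by
  have hunif : ∀ s, s ∉ twoStepCentralizer G 2 → s ∉ twoStepCentralizer G k →
      ∀ i, 2 ≤ i → i ≤ k → s ∉ twoStepCentralizer G i := by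
    intro s h2 hsk i hi hik
    rcases hik.lt_or_eq with hlt | rfl
    · rwa [hC i hi hlt]
    · exact hsk
  obtain ⟨s, hs2, hsk⟩ := exists_notMem_and_notMem
    (h.twoStepCentralizer_ne_top (i := 2) le_rfl (by omega))
    (h.twoStepCentralizer_ne_top (i := k) hk (by omega))
  have hs := hunif s hs2 hsk
  -- The Engel term of z lies in `lcs G (p + 1)`, and k + 1 < p + 1.
  have hder : ∀ z ∈ lcs G 2, z ^ p ∈ lcs G (k + 1) := by
    intro z hz
    have h1 := pow_mul_engel_mem h.prime (e := k + 1) (j₀ := 2) le_rfl (s := s)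
      (fun x hx => h.mul_pow_mul_inv_mem' (by omega) (by omega) hs hx) le_rfl hz
    have h2 := mem_lcs_of_le (i := k + 1) (by omega) (iterate_commutator_mem_lcs s hz (p - 1))
    exact (Subgroup.mul_mem_cancel_right _ h2).1 (mem_lcs_of_le (by omega) h1)
  have hmul : ∀ a b : G, ((a * b : G) : G ⧸ lcs G (k + 1)) ^ p =
      (a : G ⧸ lcs G (k + 1)) ^ p * (b : G ⧸ lcs G (k + 1)) ^ p := by
    intro a b
    have := pow_mul_congr h.prime (F := lcs G) lcs_antitone commutator_lcs_le
      (R := lcs G (k + 1)) (lcs_antitone (by omega)) hder (x := a) (y := b) (mem_top a) (mem_top b)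
    exact QuotientGroup.eq.2 this
  let π : G →* G ⧸ lcs G (k + 1) :=
    { toFun := fun a => (a : G ⧸ lcs G (k + 1)) ^ p
      map_one' := by simp
      map_mul' := hmul }
  have hπ : ∀ a, a ∈ π.ker ↔ a ^ p ∈ lcs G (k + 1) := fun a => by
    rw [MonoidHom.mem_ker, ← QuotientGroup.eq_one_iff]; rfl
  rw [← hπ]
  have hKer : ∀ a, a ∉ twoStepCentralizer G 2 → a ∉ twoStepCentralizer G k → a ∈ π.ker :=
    fun a h2 hak => (hπ a).2 (h.pow_mem_lcs_of_notMem (by omega) (by omega) (hunif a h2 hak))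
  have hodd : Odd (Nat.card G) := by
    rw [h.card_eq]
    exact (h.prime.odd_of_ne_two (by omega)).pow
  by_cases hg2 : g ∈ twoStepCentralizer G 2
  · exact mem_of_compl_union_subset hodd hKer hs2 hsk hg2
  · by_cases hgk : g ∈ twoStepCentralizer G k
    · exact mem_of_compl_union_subset hodd (fun a h1 h2 => hKer a h2 h1) hsk hs2 hgk
    · exact hKer g hg2 hgk

/-- Either the centralizers coincide and some generator avoids them, or their first change forces G
to be so small that all p-th powers lie in the last term. -/
theorem pow_mem_or_pow_mem (h : IsMaximalClass p n G) (hp : 3 ≤ p) {a b : G}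
    (hab : closure {a, b} = ⊤) : a ^ p ∈ lcs G (n - 1) ∨ b ^ p ∈ lcs G (n - 1) := by
  rcases h.three_le.eq_or_lt with rfl | hn
  · exact Or.inl (h.pow_mem_lcs_two a)
  by_cases hall : ∀ i, 2 ≤ i → i + 1 < n → twoStepCentralizer G i = twoStepCentralizer G 2
  · have hpow : ∀ s, s ∉ twoStepCentralizer G 2 → s ^ p ∈ lcs G (n - 1) := by
      intro s hs
      have := h.pow_mem_lcs_of_notMem (k := n - 2) (by omega) (by omega) (s := s)
        (fun i hi hin => by rwa [hall i hi (by omega)])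
      rwa [show n - 2 + 1 = n - 1 by omega] at this
    by_contra! hcon
    refine h.twoStepCentralizer_ne_top (i := 2) le_rfl (by omega) (top_le_iff.1 ?_)
    rw [← hab, closure_le, Set.insert_subset_iff, Set.singleton_subset_iff]
    exact ⟨not_not.1 fun h0 => hcon.1 (hpow a h0), not_not.1 fun h0 => hcon.2 (hpow b h0)⟩
  · left
    classical
    have hex : ∃ i, 2 ≤ i ∧ i + 1 < n ∧ twoStepCentralizer G i ≠ twoStepCentralizer G 2 := by
      push Not at hall
      exact hall
    obtain ⟨k, ⟨hk2, hkn, hkne⟩, hmin⟩ :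
        ∃ k, (2 ≤ k ∧ k + 1 < n ∧ twoStepCentralizer G k ≠ twoStepCentralizer G 2) ∧
        ∀ i < k, ¬ (2 ≤ i ∧ i + 1 < n ∧ twoStepCentralizer G i ≠ twoStepCentralizer G 2) :=
      ⟨Nat.find hex, Nat.find_spec hex, fun i hi => Nat.find_min hex hi⟩
    have hC : ∀ i, 2 ≤ i → i < k → twoStepCentralizer G i = twoStepCentralizer G 2 := by
      intro i hi hik
      by_contra hne
      exact hmin i hik ⟨hi, by omega, hne⟩
    have hk3 : 3 ≤ k := by
      rcases hk2.eq_or_lt with rfl | hlt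
      · exact absurd rfl hkne
      · exact hlt
    -- A proper inclusion of the first centralizer in the k-th would make the latter the whole
    -- group.
    obtain ⟨y, hy2, hyk⟩ : ∃ y ∈ twoStepCentralizer G 2, y ∉ twoStepCentralizer G k := by
      by_contra! hle
      obtain ⟨y, hy, hy'⟩ := h.exists_mem_twoStepCentralizer (i := 2) le_rfl (by omega)
      obtain ⟨s, hs, hs'⟩ := SetLike.exists_of_lt (lt_of_le_of_ne hle hkne.symm)
      exact h.twoStepCentralizer_ne_top hk2 hkn (h.eq_top_of_mem (lcs_two_le_twoStepCentralizer 2) hy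
        hy' hs' (lcs_two_le_twoStepCentralizer k) (hle y hy) hs)
    obtain ⟨s, hs2, hsk⟩ := exists_notMem_and_notMem
      (h.twoStepCentralizer_ne_top (i := 2) le_rfl (by omega))
      (h.twoStepCentralizer_ne_top hk2 hkn)
    have hs : ∀ i, 2 ≤ i → i ≤ k → s ∉ twoStepCentralizer G i := by
      intro i hi hik
      rcases hik.lt_or_eq with hlt | rfl
      · rwa [hC i hi hlt]
      · exact hsk
    have hy : ∀ i, 2 ≤ i → i < k → y ∈ twoStepCentralizer G i := fun i hi hik =>
      (hC i hi hik).symm ▸ hy2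
    have hkp : k ≤ p := by
      by_contra hlt
      exact hyk (h.mem_twoStepCentralizer_of_lt hp (by omega) hkn hs hy)
    obtain ⟨m, rfl, hm⟩ := h.exists_eq_two_mul hk3 hkn hs hy hyk
    -- Otherwise p ∣ m, against 2m ≤ p.
    have hn2 : n ≤ 2 * m + 2 := by
      by_contra hlt
      have := Nat.le_of_dvd (by omega) (hm (by omega))
      omega
    have hne : 2 * m ≠ p := by
      rintro rfl
      have := (Nat.prime_mul_iff.1 h.prime)
      omega
    have := h.pow_mem_of_le hp hk2 (by omega) (by omega) hC a
    rwa [show 2 * m + 1 = n - 1 by omega] at this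

end IsMaximalClass
end PowerStructure

/-! ### Beauville structures and their lifts -/

section Beauville

open Subgroup

theorem mem_beauvilleSigma_of_comm {V : Type*} [CommGroup V] {x y z : V} :
    z ∈ beauvilleSigma x y ↔ z ∈ zpowers x ∨ z ∈ zpowers y ∨ z ∈ zpowers (x * y) := by
  constructor
  · rintro ⟨t, ht, g, w, hw, rfl⟩
    rw [mul_comm g⁻¹, mul_assoc, inv_mul_cancel, mul_one]
    rcases ht with rfl | rfl | rfl
    · exact Or.inl hw
    · exact Or.inr (Or.inl hw)
    · exact Or.inr (Or.inr hw)
  · rintro (h | h | h)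
    · exact ⟨x, by simp, 1, z, h, by simp⟩
    · exact ⟨y, by simp, 1, z, h, by simp⟩
    · exact ⟨x * y, by simp, 1, z, h, by simp⟩

theorem zpowers_le_beauvilleSigma {Q : Type*} [Group Q] {x y t : Q}
    (ht : t ∈ ({x, y, x * y} : Set Q)) :
    (zpowers t : Set Q) ⊆ beauvilleSigma x y := fun z hz => ⟨t, ht, 1, z, hz, by simp⟩

section ElementaryAbelian

variable {p : ℕ} {V : Type*} [CommGroup V] [Finite V]

theorem closure_pair_eq_top (hp : p.Prime) (hV : Nat.card V = p ^ 2) {u v : V} (hu : u ≠ 1)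
    (hv : v ∉ zpowers u) : closure {u, v} = ⊤ := by
  have : Fact p.Prime := ⟨hp⟩
  have hG : IsPGroup p V := IsPGroup.of_card hV
  have h1 : zpowers u < closure {u, v} := by
    refine lt_of_le_of_ne ?_ fun heq => hv (heq ▸ subset_closure (by simp))
    rw [zpowers_le]
    exact subset_closure (by simp)
  have h0 : (⊥ : Subgroup V) < zpowers u := bot_lt_iff_ne_bot.2 fun h => hu (zpowers_eq_bot.1 h)
  have l1 := prime_le_relIndex hp hG h1
  have l0 := prime_le_relIndex hp hG h0
  have e1 := relIndex_mul_relIndex _ _ _ h0.le h1.le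
  rw [relIndex_bot_left (closure {u, v})] at e1
  refine eq_top_of_le_card _ ?_
  rw [hV, ← e1, pow_two]
  exact Nat.mul_le_mul l0 l1

omit [Finite V] in
theorem zpowers_ne_top (hp : p.Prime) (hV : Nat.card V = p ^ 2)
    (hpow : ∀ v : V, v ^ p = 1) (u : V) : zpowers u ≠ ⊤ := by
  intro h
  have h3 : Nat.card (zpowers u) = p ^ 2 := by rw [h, card_top, hV]
  rw [Nat.card_zpowers] at h3
  have h4 := orderOf_dvd_of_pow_eq_one (hpow u)
  rw [h3] at h4
  have := Nat.le_of_dvd hp.pos h4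
  have := hp.one_lt
  nlinarith

theorem exists_independent_pair (hp : p.Prime) (hV : Nat.card V = p ^ 2)
    (hpow : ∀ v : V, v ^ p = 1) : ∃ u v : V, u ≠ 1 ∧ v ∉ zpowers u := by
  have h1 : Nontrivial V := by
    rw [← Finite.one_lt_card_iff_nontrivial, hV]
    exact Nat.one_lt_pow two_ne_zero hp.one_lt
  obtain ⟨u, hu⟩ := exists_ne (1 : V)
  refine ⟨u, ?_⟩
  by_contra! h
  exact zpowers_ne_top hp hV hpow u (eq_top_iff.2 fun v _ => h v hu)

omit [Finite V] in
theorem zpow_eq_one_of_dvd (hpow : ∀ v : V, v ^ p = 1) (v : V) {k : ℤ} (hk : (p : ℤ) ∣ k) :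
    v ^ k = 1 := by
  obtain ⟨c, rfl⟩ := hk
  rw [zpow_mul, zpow_natCast, hpow, one_zpow]

omit [Finite V] in
theorem dvd_of_zpow_eq_one (hp : p.Prime) (hpow : ∀ v : V, v ^ p = 1) {v : V} (hv : v ≠ 1) {k : ℤ}
    (hk : v ^ k = 1) : (p : ℤ) ∣ k := by
  have : Fact p.Prime := ⟨hp⟩
  rw [← orderOf_eq_prime (hpow v) hv]
  exact orderOf_dvd_iff_zpow_eq_one.2 hk

omit [Finite V] in
theorem dvd_of_zpow_mul_zpow_eq_one (hp : p.Prime) (hpow : ∀ v : V, v ^ p = 1) {u v : V}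
    (hu : u ≠ 1) (hv : v ∉ zpowers u) {a b : ℤ} (hab : u ^ a * v ^ b = 1) :
    (p : ℤ) ∣ a ∧ (p : ℤ) ∣ b := by
  have hb : (p : ℤ) ∣ b := by
    by_contra hb
    have hcop : IsCoprime b (p : ℤ) :=
      ((Nat.prime_iff_prime_int.1 hp).coprime_iff_not_dvd.2 hb).symm
    obtain ⟨c, d, hcd⟩ := hcop
    apply hv
    have h1 : v = (v ^ b) ^ c := by
      rw [← zpow_mul, mul_comm, ← mul_one (v ^ (c * b)),
        ← zpow_eq_one_of_dvd hpow v (Dvd.intro_left d rfl), ← zpow_add, hcd, zpow_one]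
    rw [h1, eq_inv_of_mul_eq_one_right hab]
    exact zpow_mem (inv_mem (zpow_mem (mem_zpowers u) a)) c
  refine ⟨?_, hb⟩
  rw [zpow_eq_one_of_dvd hpow v hb, mul_one] at hab
  exact dvd_of_zpow_eq_one hp hpow hu hab

omit [Finite V] in
theorem eq_one_of_mem_zpowers (hp : p.Prime) (hpow : ∀ v : V, v ^ p = 1) {u v : V}
    (hu : u ≠ 1) (hv : v ∉ zpowers u) {a b c d : ℤ} (hdet : ¬ (p : ℤ) ∣ a * d - b * c) {z : V}
    (h1 : z ∈ zpowers (u ^ a * v ^ b)) (h2 : z ∈ zpowers (u ^ c * v ^ d)) : z = 1 := by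
  obtain ⟨i, rfl⟩ := mem_zpowers_iff.1 h1
  obtain ⟨j, hj⟩ := mem_zpowers_iff.1 h2
  have h3 : u ^ (a * i - c * j) * v ^ (b * i - d * j) = 1 := by
    rw [zpow_sub, zpow_sub, zpow_mul, zpow_mul, zpow_mul, zpow_mul, mul_mul_mul_comm, ← mul_inv,
      ← mul_zpow, ← mul_zpow, hj, mul_inv_cancel]
  obtain ⟨k1, k2⟩ := dvd_of_zpow_mul_zpow_eq_one hp hpow hu hv h3
  have h4 : (p : ℤ) ∣ (a * d - b * c) * i := by
    rw [show (a * d - b * c) * i = d * (a * i - c * j) - c * (b * i - d * j) by ring]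
    exact dvd_sub (k1.mul_left d) (k2.mul_left c)
  exact zpow_eq_one_of_dvd hpow _
    (((Nat.prime_iff_prime_int.1 hp).dvd_or_dvd h4).resolve_left hdet)

/-- The vectors (1,0), (0,1), (1,1) and (1,2), (1,-1), (2,1) span six distinct lines: the
determinants needed are at most 3 in absolute value, hence non-zero modulo p ≥ 5. -/
theorem exists_isBeauvilleStructure (hp : p.Prime) (hp5 : 5 ≤ p) (hV : Nat.card V = p ^ 2)
    (hpow : ∀ v : V, v ^ p = 1) : ∃ x₁ y₁ x₂ y₂ : V, IsBeauvilleStructure x₁ y₁ x₂ y₂ := by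
  obtain ⟨u, v, hu, hv⟩ := exists_independent_pair hp hV hpow
  have hsmall : ∀ k : ℤ, k ≠ 0 → |k| < 5 → ¬ (p : ℤ) ∣ k := by
    intro k hk hk5 hdvd
    have := Int.le_of_dvd (abs_pos.2 hk) ((dvd_abs _ _).2 hdvd)
    omega
  have hne : ∀ {s t : V}, t ∉ zpowers s → s ≠ t := fun h heq => h (heq ▸ mem_zpowers _)
  have hx2 : u * v ^ 2 ≠ 1 := by
    intro h
    have := (dvd_of_zpow_mul_zpow_eq_one hp hpow hu hv (a := 1) (b := 2)
      (by rw [zpow_one]; exact_mod_cast h)).1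
    exact hsmall 1 one_ne_zero (by norm_num) this
  have hy2 : u * v⁻¹ ∉ zpowers (u * v ^ 2) := by
    intro h
    have h1 := eq_one_of_mem_zpowers hp hpow hu hv (a := 1) (b := -1) (c := 1) (d := 2)
      (hsmall _ (by norm_num) (by norm_num)) (z := u * v⁻¹)
      (by rw [zpow_one, zpow_neg_one]; exact mem_zpowers _)
      (by rw [zpow_one]; exact_mod_cast h)
    have := (dvd_of_zpow_mul_zpow_eq_one hp hpow hu hv (a := 1) (b := -1)
      (by rw [zpow_one, zpow_neg_one]; exact h1)).1
    exact hsmall 1 one_ne_zero (by norm_num) this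
  have hmul : u * v ^ 2 * (u * v⁻¹) = u ^ (2 : ℤ) * v ^ (1 : ℤ) := by
    rw [show (2 : ℤ) = 1 + 1 from rfl, zpow_add, zpow_one, zpow_one, pow_two, mul_mul_mul_comm,
      mul_assoc v v, mul_inv_cancel, mul_one]
  have hmem : ∀ (a b c d : ℤ), a * d - b * c ≠ 0 → |a * d - b * c| < 5 → ∀ {s t z : V},
      s = u ^ a * v ^ b → t = u ^ c * v ^ d → z ∈ zpowers s → z ∈ zpowers t → z = 1 := by
    rintro a b c d h1 h2 s t z rfl rfl hs ht
    exact eq_one_of_mem_zpowers hp hpow hu hv (hsmall _ h1 h2) hs ht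
  refine ⟨u, v, u * v ^ 2, u * v⁻¹, hne hv, hne hy2, closure_pair_eq_top hp hV hu hv,
    closure_pair_eq_top hp hV hx2 hy2, ?_⟩
  ext z
  rw [Set.mem_inter_iff, Set.mem_singleton_iff, mem_beauvilleSigma_of_comm,
    mem_beauvilleSigma_of_comm]
  constructor
  · have a1 : u = u ^ (1 : ℤ) * v ^ (0 : ℤ) := by simp
    have a2 : v = u ^ (0 : ℤ) * v ^ (1 : ℤ) := by simp
    have a3 : u * v = u ^ (1 : ℤ) * v ^ (1 : ℤ) := by simp
    have b1 : u * v ^ 2 = u ^ (1 : ℤ) * v ^ (2 : ℤ) := by rw [zpow_one]; norm_cast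
    have b2 : u * v⁻¹ = u ^ (1 : ℤ) * v ^ (-1 : ℤ) := by simp
    rintro ⟨h | h | h, h' | h' | h'⟩
    · exact hmem _ _ _ _ (by norm_num) (by norm_num) a1 b1 h h'
    · exact hmem _ _ _ _ (by norm_num) (by norm_num) a1 b2 h h'
    · exact hmem _ _ _ _ (by norm_num) (by norm_num) a1 hmul h h'
    · exact hmem _ _ _ _ (by norm_num) (by norm_num) a2 b1 h h'
    · exact hmem _ _ _ _ (by norm_num) (by norm_num) a2 b2 h h'
    · exact hmem _ _ _ _ (by norm_num) (by norm_num) a2 hmul h h'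
    · exact hmem _ _ _ _ (by norm_num) (by norm_num) a3 b1 h h'
    · exact hmem _ _ _ _ (by norm_num) (by norm_num) a3 b2 h h'
    · exact hmem _ _ _ _ (by norm_num) (by norm_num) a3 hmul h h'
  · rintro rfl
    exact ⟨Or.inl (one_mem _), Or.inl (one_mem _)⟩

omit [Finite V] in
/-- The elements `x`, `y`, `x y` attached to a generating pair are non-trivial. -/
theorem ne_one_of_closure_eq_top (hp : p.Prime) (hV : Nat.card V = p ^ 2)
    (hpow : ∀ v : V, v ^ p = 1) {x y t : V} (hxy : closure {x, y} = ⊤)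
    (ht : t ∈ ({x, y, x * y} : Set V)) : t ≠ 1 := by
  have key : ∀ u : V, ¬ (x ∈ zpowers u ∧ y ∈ zpowers u) := by
    rintro u ⟨hx, hy⟩
    refine zpowers_ne_top hp hV hpow u (top_le_iff.1 ?_)
    rw [← hxy, closure_le, Set.insert_subset_iff, Set.singleton_subset_iff]
    exact ⟨hx, hy⟩
  rintro rfl
  rcases ht with h | h | h
  · exact key y ⟨h ▸ one_mem _, mem_zpowers y⟩
  · exact key x ⟨mem_zpowers x, (Set.mem_singleton_iff.1 h) ▸ one_mem _⟩
  · have h1 : y = x⁻¹ := eq_inv_of_mul_eq_one_right (Set.mem_singleton_iff.1 h).symm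
    exact key x ⟨mem_zpowers x, h1 ▸ inv_mem (mem_zpowers x)⟩

end ElementaryAbelian

variable {p : ℕ} {Q : Type*} [Group Q] [Finite Q]

theorem rank_eq_two_of_closure_pair (hc : ¬ IsCyclic Q) {x y : Q} (hxy : closure {x, y} = ⊤) :
    Group.rank Q = 2 := by
  classical
  refine le_antisymm ?_ ?_
  · refine (Group.rank_le (S := {x, y}) (by simpa using hxy)).trans Finset.card_le_two
  · by_contra hlt
    obtain ⟨S, hS, hS'⟩ := Group.rank_spec Q
    have h1 : S.card ≤ 1 := by omega
    obtain ⟨x, hx⟩ := Finset.card_le_one_iff_subset_singleton.1 h1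
    refine hc ⟨x, fun y => ?_⟩
    have h2 : closure (S : Set Q) ≤ zpowers x := by
      rw [closure_le]
      intro z hz
      rw [Finset.mem_singleton.1 (hx hz)]
      exact mem_zpowers x
    exact h2 (hS' ▸ mem_top y)

/-- A non-cyclic `2`-generator `p`-group in which one element of each generating pair has order `p`
is a Beauville group of tame type. -/
theorem isBeauvilleOfTameType_of_pow_eq_one (hp : p.Prime) (hp5 : 5 ≤ p) (hQ : IsPGroup p Q)
    (hc : ¬ IsCyclic Q) (hindex : (frattini Q).index ≤ p ^ 2)
    (hpow : ∀ a b : Q, closure {a, b} = ⊤ → a ^ p = 1 ∨ b ^ p = 1) :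
    IsBeauvilleOfTameType Q := by
  let _ : CommGroup (Q ⧸ frattini Q) :=
    { (inferInstance : Group (Q ⧸ frattini Q)) with
      mul_comm := fun a b => by
        have := Subgroup.Normal.quotient_commutative_iff_commutator_le.2
          (commutator_le_frattini hp hQ)
        exact this.is_comm.comm a b }
  have hV : Nat.card (Q ⧸ frattini Q) = p ^ 2 := le_antisymm hindex (sq_le_index_frattini hp hQ hc)
  have hVpow : ∀ v : Q ⧸ frattini Q, v ^ p = 1 := by
    intro v
    obtain ⟨x, rfl⟩ := QuotientGroup.mk'_surjective _ v
    exact (QuotientGroup.eq_one_iff _).2 (pow_mem_frattini hp hQ x)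
  have hgen : ∀ {a b : Q}, closure {(a : Q ⧸ frattini Q), (b : Q ⧸ frattini Q)} = ⊤ →
      closure {a, b} = ⊤ := by
    intro a b h
    apply closure_eq_top_of_map_frattini
    rwa [Set.image_pair]
  have hlift : ∀ x₁ y₁ x₂ y₂ : Q,
      IsBeauvilleStructure (x₁ : Q ⧸ frattini Q) (y₁ : Q ⧸ frattini Q)
        (x₂ : Q ⧸ frattini Q) (y₂ : Q ⧸ frattini Q) →
      IsBeauvilleStructure x₁ y₁ x₂ y₂ := by
    intro x₁ y₁ x₂ y₂ h
    refine ⟨fun h0 => h.ne₁ (h0 ▸ rfl), fun h0 => h.ne₂ (h0 ▸ rfl), hgen h.closure₁, hgen h.closure₂,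
      ?_⟩
    ext z
    rw [Set.mem_inter_iff, Set.mem_singleton_iff]
    constructor
    swap
    · rintro rfl
      exact ⟨zpowers_le_beauvilleSigma (t := x₁) (by simp) (one_mem _),
        zpowers_le_beauvilleSigma (t := x₂) (by simp) (one_mem _)⟩
    rintro ⟨⟨t₁, ht₁, g₁, w₁, hw₁, hz₁⟩, ⟨t₂, ht₂, g₂, w₂, hw₂, hz₂⟩⟩
    have hmk : ∀ {x y t : Q}, t ∈ ({x, y, x * y} : Set Q) → (t : Q ⧸ frattini Q) ∈
        ({(x : Q ⧸ frattini Q), (y : Q ⧸ frattini Q), (x : Q ⧸ frattini Q) * y} :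
          Set (Q ⧸ frattini Q)) := by
      rintro x y t (rfl | rfl | rfl) <;> simp
    have hmz : ∀ {t w : Q}, w ∈ zpowers t →
        (w : Q ⧸ frattini Q) ∈ zpowers (t : Q ⧸ frattini Q) := by
      intro t w hw
      obtain ⟨k, rfl⟩ := mem_zpowers_iff.1 hw
      exact ⟨k, rfl⟩
    have hdis : ∀ v : Q ⧸ frattini Q, v ∈ zpowers (t₁ : Q ⧸ frattini Q) →
        v ∈ zpowers (t₂ : Q ⧸ frattini Q) → v = 1 := by
      intro v h1 h2
      have : v ∈ beauvilleSigma (x₁ : Q ⧸ frattini Q) y₁ ∩ beauvilleSigma (x₂ : Q ⧸ frattini Q) y₂ :=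
        ⟨zpowers_le_beauvilleSigma (hmk ht₁) h1, zpowers_le_beauvilleSigma (hmk ht₂) h2⟩
      rw [h.inter] at this
      exact this
    have hn₁ := ne_one_of_closure_eq_top hp hV hVpow h.closure₁ (hmk ht₁)
    have hn₂ := ne_one_of_closure_eq_top hp hV hVpow h.closure₂ (hmk ht₂)
    -- The images of t₁ and t₂ span different lines of the Frattini quotient, so the hypothesis on
    -- generating pairs applies to t₁, t₂.
    have htop : closure {t₁, t₂} = ⊤ := hgen (closure_pair_eq_top hp hV hn₁ fun h0 =>
      hn₂ (hdis _ h0 (mem_zpowers _)))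
    have hzw : ∀ {g w : Q}, z = g⁻¹ * w * g → (z : Q ⧸ frattini Q) = w := by
      rintro g w rfl
      rw [QuotientGroup.mk_mul, QuotientGroup.mk_mul, QuotientGroup.mk_inv, mul_comm,
        mul_inv_cancel_left]
    have hz1 : (z : Q ⧸ frattini Q) = 1 :=
      hdis _ (hzw hz₁ ▸ hmz hw₁) (hzw hz₂ ▸ hmz hw₂)
    -- If t^p = 1 and t lies outside the Frattini subgroup, a power of t inside it has exponent
    -- divisible by p.
    have hfin : ∀ {t w g : Q}, t ^ p = 1 → (t : Q ⧸ frattini Q) ≠ 1 → w ∈ zpowers t →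
        z = g⁻¹ * w * g → z = 1 := by
      intro t w g htp ht hw hz
      obtain ⟨k, rfl⟩ := mem_zpowers_iff.1 hw
      have h1 : (t : Q ⧸ frattini Q) ^ k = 1 := by rw [← hz1, hzw hz]; rfl
      obtain ⟨c, rfl⟩ := dvd_of_zpow_eq_one hp hVpow ht h1
      rw [hz, zpow_mul, zpow_natCast, htp]
      simp
    rcases hpow t₁ t₂ htop with h1 | h1
    · exact hfin h1 hn₁ hw₁ hz₁
    · exact hfin h1 hn₂ hw₂ hz₂
  refine ⟨?_, hlift⟩
  obtain ⟨x₁, y₁, x₂, y₂, h⟩ := exists_isBeauvilleStructure hp hp5 hV hVpow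
  obtain ⟨x₁, rfl⟩ := QuotientGroup.mk'_surjective _ x₁
  obtain ⟨y₁, rfl⟩ := QuotientGroup.mk'_surjective _ y₁
  obtain ⟨x₂, rfl⟩ := QuotientGroup.mk'_surjective _ x₂
  obtain ⟨y₂, rfl⟩ := QuotientGroup.mk'_surjective _ y₂
  have h' := hlift x₁ y₁ x₂ y₂ h
  exact ⟨rank_eq_two_of_closure_pair hc h'.closure₁, x₁, y₁, x₂, y₂, h'⟩

theorem IsMaximalClass.isBeauvilleOfTameType_quotient {n : ℕ} {G : Type*} [Group G] [Finite G]
    (h : IsMaximalClass p n G) (hp5 : 5 ≤ p) {m : ℕ} (hm : 2 ≤ m) (hmn : m < n)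
    {N : Subgroup G} [N.Normal] (hN : N = lcs G m) : IsBeauvilleOfTameType (G ⧸ N) := by
  have hNF : N ≤ frattini G := by
    rw [hN, h.frattini_eq]; exact lcs_antitone hm
  have hlift : ∀ s : Set G, closure ((QuotientGroup.mk' N) '' s) = ⊤ → closure s = ⊤ := by
    intro s hs
    rw [← MonoidHom.map_closure] at hs
    have := congrArg (comap (QuotientGroup.mk' N)) hs
    rw [comap_map_eq, QuotientGroup.ker_mk', comap_top] at this
    exact frattini_nongenerating (top_le_iff.1 (this.ge.trans (sup_le_sup_left hNF _)))
  refine isBeauvilleOfTameType_of_pow_eq_one h.prime hp5 (h.isPGroup.to_quotient N) ?_ ?_ ?_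
  · rintro ⟨g, hg⟩
    obtain ⟨x, rfl⟩ := QuotientGroup.mk'_surjective _ g
    have h1 := hlift {x} (by
      rw [Set.image_singleton, ← zpowers_eq_closure, eq_top_iff]
      exact fun y _ => hg y)
    rw [← zpowers_eq_closure] at h1
    exact h.not_isCyclic ⟨x, fun y => (h1 ▸ mem_top y : y ∈ zpowers x)⟩
  · have hle := frattini_le_comap_frattini_of_surjective (QuotientGroup.mk'_surjective N)
    rw [← index_comap_of_surjective _ (QuotientGroup.mk'_surjective N),
      ← h.index_lcs 2 le_rfl (by have := h.three_le; omega), ← h.frattini_eq]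
    exact Nat.le_of_dvd (Nat.pos_of_ne_zero index_ne_zero_of_finite) (index_dvd_of_le hle)
  · intro a b hab
    obtain ⟨a, rfl⟩ := QuotientGroup.mk'_surjective _ a
    obtain ⟨b, rfl⟩ := QuotientGroup.mk'_surjective _ b
    have h1 := hlift {a, b} (by rwa [Set.image_pair])
    have hle : lcs G (n - 1) ≤ N := hN ▸ lcs_antitone (by omega)
    exact (h.pow_mem_or_pow_mem (by omega) h1).imp
      (fun h2 => (QuotientGroup.eq_one_iff _).2 (hle h2))
      (fun h2 => (QuotientGroup.eq_one_iff _).2 (hle h2))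

end Beauville

theorem corollary2p7 (p : ℕ) (hp : p.Prime) (hp5 : 5 ≤ p)
    (G : Type*) [Group G] [Finite G] (hG : IsPGroupOfMaximalClass p G)
    (N : Subgroup G) [N.Normal] (hN : N ≠ ⊥) (hcard : p ^ 2 ≤ Nat.card (G ⧸ N)) :
    IsBeauvilleGroup (G ⧸ N) ∧ IsBeauvilleOfTameType (G ⧸ N) := by
  suffices h : IsBeauvilleOfTameType (G ⧸ N) from ⟨h.1, h⟩
  have : Fact p.Prime := ⟨hp⟩
  obtain ⟨hnil, n, -, hGn, hcl⟩ := hG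
  obtain ⟨m, hm⟩ := (IsPGroup.of_card hGn).index N
  have hm2 : 2 ≤ m := by
    have : p ^ 2 ≤ p ^ m := hm ▸ hcard
    exact (Nat.pow_le_pow_iff_right hp.one_lt).1 this
  have hmn : m < n := by
    have h1 := Subgroup.card_mul_index N
    have h2 : 1 < Nat.card N := (Subgroup.one_lt_card_iff_ne_bot N).2 hN
    rw [hm, hGn] at h1
    refine (Nat.pow_lt_pow_iff_right hp.one_lt).1 ?_
    have := pow_pos hp.pos m
    nlinarith
  -- The condition 3 ≤ n comes from 2 ≤ m < n, so the abelian case n = 2 does not arise.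
  have h := isMaximalClass_of_card hp (by omega) hGn hcl
  exact h.isBeauvilleOfTameType_quotient hp5 hm2 hmn (h.eq_lcs_of_index hm2 hmn.le hm)
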